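/- Let $Y_i=\theta_i+\sigma\xi_i$, $i=1,\dots,d$, where $\sigma>0$ and $\xi_1,\dots,\xi_d$ are i.i.d. real random variables with law $P_\xi$; write $\mathbf E_{\theta,P_\xi,\sigma}$ for the expectation under the law of $Y=(Y_1,\dots,Y_d)$, and $\|\theta\|_0$ for the number of nonzero coordinates of $\theta\in\mathbb R^d$. For $a,\tau>0$ let $\mathcal G_{a,\tau}$ (respectively $\mathcal P_{a,\tau}$) be the set of all probability laws $P_\xi$ on $\mathbb R$ with $\mathbf E\xi_1=0$, $\mathbf E\xi_1^2=1$ and $\mathbf P(|\xi_1|>t)\le 2e^{-(t/\tau)^a}$ (respectively $\mathbf P(|\xi_1|>t)\le(\tau/t)^a$) for all $t\ge 2$. *Variance estimator.* For $\gamma\in(0,1/2]$ put $m=\lfloor\gamma d\rfloor$, and when $m\ge 1$ divide $\{1,\dots,d\}$ into disjoint subsets $B_1,\dots,B_m$ with $|B_i|\ge\lfloor d/m\rfloor$. Let $\tilde\sigma^2=\tilde\sigma^2(Y)$ be the median of $\bar\sigma_1^2,\dots,\bar\sigma_m^2$, where $\bar\sigma_i^2=|B_i|^{-1}\sum_{j\in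 B_i}Y_j^2$ (if $m$ is even, any measurable choice of a median, i.e. of a number between the two middle values), and $\tilde\sigma=\sqrt{\tilde\sigma^2}$. *Estimator of $\theta$.* For weights $\lambda_1\ge\dots\ge\lambda_d>0$ let $$\hat\theta\in\operatorname*{arg\,min}_{\vartheta\in\mathbb R^d}\Big(\sum_{i=1}^d(Y_i-\vartheta_i)^2+\tilde\sigma\sum_{i=1}^d\lambda_i|\vartheta|_{(d-i+1)}\Big),$$ where $|\vartheta|_{(1)}\le\dots\le|\vartheta|_{(d)}$ are the order statistics of $|\vartheta_1|,\dots,|\vartheta_d|$. **Theorem.** 1. Let $a>0$ and $\tau>0$. There exist constants $c,C>0$ and $\gamma\in(0,1/2]$ depending only on $(a,\tau)$ such that, for all integers $s,d$ with $1\le s<\lfloor\gamma d\rfloor/4$ and for every choice of the blocks as above, the estimator $\hat\theta$ with $\lambda_j=c\log^{1/a}(ed/j)$, $j=1,\dots,d$, satisfies $$\sup_{P_\xi\in\mathcal G_{a,\tau}}\ \sup_{\sigma>0}\ \sup_{\|\theta\|_0\le s}\ \sigma^{-2}\,\mathbf E_{\theta,P_\xi,\sigma}\|\hat\theta-\theta\|_2^2\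 \le\ C\,s\log^{2/a}(ed/s).$$ 2. Let $a>2$ and $\tau>0$. There exist constants $c,C>0$ and $\gamma\in(0,1/2]$ depending only on $(a,\tau)$ such that, for all integers $s,d$ with $1\le s<\lfloor\gamma d\rfloor/4$ and for every choice of the blocks as above, the estimator $\hat\theta$ with $\lambda_j=c\,(d/j)^{1/a}$, $j=1,\dots,d$, satisfies $$\sup_{P_\xi\in\mathcal P_{a,\tau}}\ \sup_{\sigma>0}\ \sup_{\|\theta\|_0\le s}\ \sigma^{-2}\,\mathbf E_{\theta,P_\xi,\sigma}\|\hat\theta-\theta\|_2^2\ \le\ C\,s\,(d/s)^{2/a}.$$ -/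

import Mathlib

open MeasureTheory

noncomputable section

/-- The class `G_{a,τ}` of noise laws: centred probability measures on `ℝ` with unit second moment
and `P(|ξ| > t) ≤ 2 exp(-(t/τ)^a)` for all `t ≥ 2`. (The equation `∫ x ^ 2 = 1` forces
`x ^ 2`, hence also `x`, to be integrable.) -/
def expTailClass (a τ : ℝ) : Set (Measure ℝ) :=
  {P | IsProbabilityMeasure P ∧ ∫ x, x ∂P = 0 ∧ ∫ x, x ^ 2 ∂P = 1 ∧
    ∀ t : ℝ, 2 ≤ t → P.real {x | t < |x|} ≤ 2 * Real.exp (-(t / τ) ^ a)}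

/-- The class `P_{a,τ}` of noise laws: centred probability measures on `ℝ` with unit second moment
and `P(|ξ| > t) ≤ (τ/t)^a` for all `t ≥ 2`. -/
def polTailClass (a τ : ℝ) : Set (Measure ℝ) :=
  {P | IsProbabilityMeasure P ∧ ∫ x, x ∂P = 0 ∧ ∫ x, x ^ 2 ∂P = 1 ∧
    ∀ t : ℝ, 2 ≤ t → P.real {x | t < |x|} ≤ (τ / t) ^ a}

/-- The law of `Y = (Y_1, …, Y_d)`, `Y_i = θ_i + σ ξ_i`, with `ξ_1, …, ξ_d` i.i.d. of law `P`. -/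
def obsLaw {d : ℕ} (θ : EuclideanSpace ℝ (Fin d)) (P : Measure ℝ) (σ : ℝ) :
    Measure (EuclideanSpace ℝ (Fin d)) :=
  (Measure.pi fun _ : Fin d => P).map
    fun ξ : Fin d → ℝ => WithLp.toLp 2 fun i => θ i + σ * ξ i

/-- The number of nonzero coordinates, `‖θ‖₀`. -/
def sparsity {d : ℕ} (θ : EuclideanSpace ℝ (Fin d)) : ℕ :=
  (Finset.univ.filter fun i => θ i ≠ 0).card

/-- The blocks `B_1, …, B_m` divide `{1, …, d}` into disjoint subsets, each of cardinality at
least `⌊d / m⌋`. -/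
structure IsBlockDivision {d m : ℕ} (B : Fin m → Finset (Fin d)) : Prop where
  disjoint : ∀ i j, i ≠ j → Disjoint (B i) (B j)
  cover : ∀ l, ∃ i, l ∈ B i
  card_le : ∀ i, d / m ≤ (B i).card

/-- The block mean `|B|⁻¹ ∑_{j ∈ B} y_j²`. -/
def blockMean {d : ℕ} (B : Finset (Fin d)) (y : EuclideanSpace ℝ (Fin d)) : ℝ :=
  (∑ j ∈ B, y j ^ 2) / (B.card : ℝ)

/-- `x` is a median of `v_1, …, v_m`: at least half of the values are `≤ x` and at least half are
`≥ x`. For odd `m` it is unique; for even `m` it is any point between the two middle values. -/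
def IsMedian {m : ℕ} (v : Fin m → ℝ) (x : ℝ) : Prop :=
  m ≤ 2 * (Finset.univ.filter fun i => v i ≤ x).card ∧
    m ≤ 2 * (Finset.univ.filter fun i => x ≤ v i).card

/-- `V` is a median-of-means estimator of `σ²` built on the blocks `B`: a measurable function of
the data which is a median of the block means. -/
def IsMedianOfMeans {d m : ℕ} (B : Fin m → Finset (Fin d))
    (V : EuclideanSpace ℝ (Fin d) → ℝ) : Prop :=
  Measurable V ∧ ∀ y, IsMedian (fun i => blockMean (B i) y) (V y)

/-- The order statistics `x_(1) ≤ ⋯ ≤ x_(d)` of a vector (indexed from `0`). -/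
def orderStat {d : ℕ} (x : Fin d → ℝ) : Fin d → ℝ := x ∘ Tuple.sort x

/-- The sorted `ℓ₁` norm `∑_{i=1}^d λ_i |θ|_(d-i+1)`; the weights `lam` are indexed from `1`,
so that index `i : Fin d` stands for `i + 1`. -/
def sortedL1 {d : ℕ} (lam : ℕ → ℝ) (θ : EuclideanSpace ℝ (Fin d)) : ℝ :=
  ∑ i : Fin d, lam (i + 1) * orderStat (fun l => |θ l|) i.rev

/-- The penalized least squares criterion `∑ (y_i - θ_i)² + σ̃ ‖θ‖_*`. -/
def slopeCriterion {d : ℕ} (lam : ℕ → ℝ) (y : EuclideanSpace ℝ (Fin d)) (σtilde : ℝ)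
    (θ : EuclideanSpace ℝ (Fin d)) : ℝ :=
  ∑ i, (y i - θ i) ^ 2 + σtilde * sortedL1 lam θ

/-- `θhat` is the SLOPE estimator with weights `lam` and plugged-in noise level `σ̃ = √V`: for all
data `y`, `θhat y` minimizes the criterion over `ℝ^d`. -/
def IsSlopeEstimator {d : ℕ} (lam : ℕ → ℝ) (V : EuclideanSpace ℝ (Fin d) → ℝ)
    (θhat : EuclideanSpace ℝ (Fin d) → EuclideanSpace ℝ (Fin d)) : Prop :=
  ∀ y, IsMinOn (slopeCriterion lam y (Real.sqrt (V y))) Set.univ (θhat y)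

/-- The weights `λ_j = c log^{1/a}(e d / j)`. -/
def expWeights (c a : ℝ) (d : ℕ) (j : ℕ) : ℝ :=
  c * Real.log (Real.exp 1 * d / j) ^ (1 / a)

/-- The weights `λ_j = c (d / j)^{1/a}`. -/
def polWeights (c a : ℝ) (d : ℕ) (j : ℕ) : ℝ :=
  c * ((d : ℝ) / j) ^ (1 / a)

/-- The rate `√s log^{1/a}(e d / s)`. -/
def phiExp (a : ℝ) (s d : ℕ) : ℝ :=
  Real.sqrt s * Real.log (Real.exp 1 * d / s) ^ (1 / a)

/-- The rate `√s (d / s)^{1/a}`. -/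
def phiPol (a : ℝ) (s d : ℕ) : ℝ :=
  Real.sqrt s * ((d : ℝ) / s) ^ (1 / a)

end

/-!
The error `u = θhat - θ` is first bounded for a fixed realization of the noise. Write `x_j` for the
`j`-th largest `|ξ_i|` and `r = √V`. The first order condition for the minimizer, the rearrangement
inequality for the noise term and the comparison `sortedL1_sub_le_of_sparse` of the sorted norms of
`θ` and `θ + u` give (`norm_sq_le_of_isMinOn`)

  `‖u‖² ≤ 2 ∑_j (2 σ x_j - r λ_j)_+² + 8 r² ∑_{j ≤ s} λ_j²`.

The weights are `λ_j = 9 T_j`. As long as `V ≥ σ² / 2`, only the excesses `(x_j - 3 T_j)_+` enter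
the first sum. Such an excess is at most `(W_j - T_j)_+` for `W_j = j⁻¹ ∑_i (|ξ_i| - 2 T_j)_+`, a
normalized sum of independent variables with mean at most `T_j`, so its second moment is at most the
variance of `W_j` (`integral_excess_sq_le`). This needs only moments of order two, which is why it
works for every polynomial tail of order `a > 2`. If `V < σ² / 2`, the first sum is bounded by the
same excesses and by `∑_j T_j²`, which is of order `d`, so it suffices that this event has
probability of order `1 / d`.

Since `s < m / 4`, at most a quarter of the blocks meet the support of `θ`. Hence `V` is at most
four times the average of the block means of the squared noise, and `V < σ² / 2` forces a quarter of
the blocks to have a small truncated noise mean. One application of Chebyshev's inequality inside a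
block and one to the number of such blocks bound the probability of the latter by `8 / m`
(`measureReal_card_truncMean_le`). The truncation level, and with it `γ`, come from the uniform
integrability of `ξ²` over the class (`exists_truncation_level`).

Both classes are reduced to power tails. The truncated second moments at `T_j = κ (d / j)^{1/a}` and
at `T_j = κ log^{1/a}(e d / j)` are computed from the tail, and sums of the weights are controlled
by regular variation (`headSq_le`).
-/

open ProbabilityTheory

/-! ### Decreasing rearrangements -/

/-- The decreasing rearrangement `x_[1] ≥ x_[2] ≥ ⋯` of a vector, indexed from `0`. -/
noncomputable def decSort {d : ℕ} (x : Fin d → ℝ) (i : Fin d) : ℝ := orderStat x i.rev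

/-- A permutation that sorts `x` in decreasing order. -/
noncomputable def decPerm {d : ℕ} (x : Fin d → ℝ) : Equiv.Perm (Fin d) :=
  Fin.revPerm.trans (Tuple.sort x)

lemma decSort_eq {d : ℕ} (x : Fin d → ℝ) (i : Fin d) : decSort x i = x (decPerm x i) := rfl

lemma decSort_antitone {d : ℕ} (x : Fin d → ℝ) : Antitone (decSort x) := fun _ _ hij =>
  Tuple.monotone_sort x (Fin.rev_le_rev.mpr hij)

lemma antitone_comp_decPerm {d : ℕ} (x : Fin d → ℝ) : Antitone fun i => x (decPerm x i) :=
  decSort_antitone x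

lemma sum_comp_decSort {d : ℕ} (x : Fin d → ℝ) (f : ℝ → ℝ) :
    ∑ i, f (decSort x i) = ∑ i, f (x i) :=
  Equiv.sum_comp (decPerm x) fun i => f (x i)

/-- The rearrangement inequality. -/
lemma sum_mul_perm_le_decSort {d : ℕ} {w : Fin d → ℝ} (hw : Antitone w) (x : Fin d → ℝ)
    (π : Equiv.Perm (Fin d)) : ∑ i, w i * x (π i) ≤ ∑ i, w i * decSort x i := by
  have hmv : Monovary w (decSort x) := hw.monovary (decSort_antitone x)
  have h := hmv.sum_mul_comp_perm_le_sum_mul (σ := π.trans (decPerm x).symm)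
  refine le_trans (le_of_eq ?_) h
  refine Finset.sum_congr rfl fun i _ => ?_
  simp [decSort_eq]

lemma sum_mul_decSort_eq_of_antitone {d : ℕ} {w : Fin d → ℝ} (hw : Antitone w) (x : Fin d → ℝ)
    (π : Equiv.Perm (Fin d)) (hπ : Antitone fun i => x (π i)) :
    ∑ i, w i * decSort x i = ∑ i, w i * x (π i) := by
  refine le_antisymm ?_ (sum_mul_perm_le_decSort hw x π)
  have hmv : Monovary w (fun i => x (π i)) := hw.monovary hπ
  have h := hmv.sum_mul_comp_perm_le_sum_mul (σ := (decPerm x).trans π.symm)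
  refine le_trans (le_of_eq ?_) h
  refine Finset.sum_congr rfl fun i _ => ?_
  simp [decSort_eq]

lemma decSort_mono {d : ℕ} {x z : Fin d → ℝ} (h : ∀ i, x i ≤ z i) (i : Fin d) :
    decSort x i ≤ decSort z i := by
  by_contra! hlt
  -- The `i + 1` positions of the largest entries of `x` have entries of `z` above `decSort z i`,
  -- while at most `i` positions have that property.
  have h1 : (Finset.Iic i).map (decPerm x).toEmbedding ⊆
      (Finset.Iio i).map (decPerm z).toEmbedding := by
    intro l hl
    obtain ⟨j, hj, rfl⟩ := Finset.mem_map.mp hl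
    refine Finset.mem_map.mpr ⟨(decPerm z).symm (decPerm x j), ?_, by simp⟩
    rw [Finset.mem_Iio]
    by_contra! hle
    have e1 := decSort_antitone z hle
    have e2 := decSort_antitone x (Finset.mem_Iic.mp hj)
    have e3 := h (decPerm x j)
    rw [decSort_eq z ((decPerm z).symm _)] at e1
    simp only [Equiv.apply_symm_apply] at e1
    rw [decSort_eq x j] at e2
    linarith
  have h2 := Finset.card_le_card h1
  simp at h2

/-- For a monotone nonnegative `f`, the value at the `j`-th largest entry is at most `1 / j` times
the sum of the values at all entries. -/
lemma decSort_le_average {d : ℕ} (x : Fin d → ℝ) {f : ℝ → ℝ} (hf : Monotone f)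
    (hf0 : ∀ t, 0 ≤ f t) (i : Fin d) :
    f (decSort x i) ≤ (∑ l, f (x l)) / ((i : ℝ) + 1) := by
  rw [le_div_iff₀ (by positivity), ← sum_comp_decSort x f]
  calc f (decSort x i) * ((i : ℝ) + 1) = ∑ _l ∈ Finset.Iic i, f (decSort x i) := by
        simp [mul_comm]
    _ ≤ ∑ l ∈ Finset.Iic i, f (decSort x l) :=
        Finset.sum_le_sum fun l hl => hf (decSort_antitone x (Finset.mem_Iic.mp hl))
    _ ≤ ∑ l, f (decSort x l) :=
        Finset.sum_le_sum_of_subset_of_nonneg (Finset.subset_univ _) fun l _ _ => hf0 _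

/-! ### The sorted `ℓ₁` norm -/

/-- Weights `lam 1 ≥ lam 2 ≥ ⋯ ≥ lam d ≥ 0`. -/
structure IsWeight (d : ℕ) (lam : ℕ → ℝ) : Prop where
  anti : Antitone fun i : Fin d => lam (i + 1)
  nonneg : ∀ i : Fin d, 0 ≤ lam (i + 1)

section sorted
variable {d : ℕ} {lam : ℕ → ℝ}

lemma sortedL1_eq (lam : ℕ → ℝ) (u : EuclideanSpace ℝ (Fin d)) :
    sortedL1 lam u = ∑ i : Fin d, lam (i + 1) * decSort (fun l => |u l|) i := rfl

lemma sum_perm_le_sortedL1 (h : IsWeight d lam) (u : EuclideanSpace ℝ (Fin d))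
    (π : Equiv.Perm (Fin d)) : ∑ i : Fin d, lam (i + 1) * |u (π i)| ≤ sortedL1 lam u :=
  sum_mul_perm_le_decSort h.anti (fun l => |u l|) π

lemma sortedL1_eq_decPerm (lam : ℕ → ℝ) (u : EuclideanSpace ℝ (Fin d)) :
    sortedL1 lam u = ∑ i : Fin d, lam (i + 1) * |u (decPerm (fun l => |u l|) i)| := rfl

lemma sortedL1_add_smul_le (h : IsWeight d lam) (u v : EuclideanSpace ℝ (Fin d)) {a b : ℝ}
    (ha : 0 ≤ a) (hb : 0 ≤ b) :
    sortedL1 lam (a • u + b • v) ≤ a * sortedL1 lam u + b * sortedL1 lam v := by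
  rw [sortedL1_eq_decPerm]
  set π := decPerm fun l => |(a • u + b • v) l|
  calc ∑ i : Fin d, lam (i + 1) * |(a • u + b • v) (π i)|
      ≤ ∑ i : Fin d, (a * (lam (i + 1) * |u (π i)|) + b * (lam (i + 1) * |v (π i)|)) := by
        refine Finset.sum_le_sum fun i _ => ?_
        have h1 : |(a • u + b • v) (π i)| ≤ a * |u (π i)| + b * |v (π i)| := by
          have := abs_add_le (a * u (π i)) (b * v (π i))
          simpa [abs_mul, abs_of_nonneg ha, abs_of_nonneg hb] using this
        calc _ ≤ lam (i + 1) * (a * |u (π i)| + b * |v (π i)|) :=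
              mul_le_mul_of_nonneg_left h1 (h.nonneg i)
          _ = _ := by ring
    _ = a * ∑ i : Fin d, lam (i + 1) * |u (π i)| + b * ∑ i : Fin d, lam (i + 1) * |v (π i)| := by
        rw [Finset.sum_add_distrib, Finset.mul_sum, Finset.mul_sum]
    _ ≤ _ := by
        gcongr
        · exact sum_perm_le_sortedL1 h u π
        · exact sum_perm_le_sortedL1 h v π

lemma abs_apply_le_norm (u : EuclideanSpace ℝ (Fin d)) (i : Fin d) : |u i| ≤ ‖u‖ := by
  simpa using PiLp.norm_apply_le u i

lemma sortedL1_le_norm (h : IsWeight d lam) (u : EuclideanSpace ℝ (Fin d)) :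
    sortedL1 lam u ≤ (∑ i : Fin d, lam (i + 1)) * ‖u‖ := by
  rw [sortedL1_eq_decPerm, Finset.sum_mul]
  exact Finset.sum_le_sum fun i _ =>
    mul_le_mul_of_nonneg_left (abs_apply_le_norm _ _) (h.nonneg i)

lemma sortedL1_sub_le (h : IsWeight d lam) (u v : EuclideanSpace ℝ (Fin d)) :
    sortedL1 lam u - sortedL1 lam v ≤ (∑ i : Fin d, lam (i + 1)) * ‖u - v‖ := by
  have h1 := sortedL1_add_smul_le h v (u - v) zero_le_one zero_le_one
  simp only [one_smul, one_mul, add_sub_cancel] at h1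
  linarith [sortedL1_le_norm h (u - v)]

/-- At a sparse vector `θ` the sorted norm decreases along `u` only through the `s` largest
entries of `u`. The proof evaluates the norm of `θ + u` on a permutation which lists the support of
`θ` first, ordered as `|θ|`, and the rest ordered as `|u|`. -/
lemma sortedL1_sub_le_of_sparse (h : IsWeight d lam) {s : ℕ} (θ u : EuclideanSpace ℝ (Fin d))
    (hs : sparsity θ ≤ s) :
    sortedL1 lam θ - sortedL1 lam (θ + u) ≤
      2 * ∑ i : Fin d, (if (i : ℕ) < s then lam (i + 1) * decSort (fun l => |u l|) i else 0)
        - sortedL1 lam u := by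
  set M : ℝ := ‖u‖
  have hM : ∀ i, |u i| ≤ M := abs_apply_le_norm u
  -- Sorting by the key `w` puts the support of `θ` first.
  set w : Fin d → ℝ := fun i => if θ i ≠ 0 then M + |θ i| else |u i| with hw
  set π := decPerm w
  have hwa : Antitone fun i => w (π i) := antitone_comp_decPerm w
  have hθw : ∀ i, |θ i| = max (w i - M) 0 := by
    intro i
    by_cases hi : θ i = 0
    · simp [hw, hi, hM i]
    · simp [hw, hi]
  have hθa : Antitone fun i => |θ (π i)| := by
    intro i j hij
    simp only [hθw]
    gcongr
    exact hwa hij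
  have hθ0 : ∀ i : Fin d, s ≤ i → θ (π i) = 0 := by
    intro i hi
    by_contra hne
    have hsub : (Finset.Iic i).map π.toEmbedding ⊆ Finset.univ.filter fun l => θ l ≠ 0 := by
      intro l hl
      obtain ⟨j, hj, rfl⟩ := Finset.mem_map.mp hl
      simp only [Finset.mem_filter, Finset.mem_univ, true_and]
      have h1 := hθa (Finset.mem_Iic.mp hj)
      have h2 : 0 < |θ (π i)| := abs_pos.mpr hne
      exact abs_pos.mp (h2.trans_le h1)
    have hc := Finset.card_le_card hsub
    unfold sparsity at hs
    simp only [Finset.card_map, Fin.card_Iic] at hc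
    omega
  have hgθ : sortedL1 lam θ = ∑ i : Fin d, lam (i + 1) * |θ (π i)| :=
    sum_mul_decSort_eq_of_antitone h.anti (fun l => |θ l|) π hθa
  have htail : ∀ i : Fin d, s ≤ i → decSort (fun l => |u l|) i ≤ |u (π i)| := by
    intro i hi
    have h1 : decSort (fun l => |u l|) i ≤ decSort w i := by
      refine decSort_mono (fun l => ?_) i
      by_cases hl : θ l = 0
      · simp [hw, hl]
      · simp only [hw, ne_eq, hl, not_false_eq_true, if_true]
        linarith [hM l, abs_nonneg (θ l)]
    have h2 : ∀ l, θ l = 0 → w l = |u l| := fun l hl => by simp [hw, hl]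
    have h3 : decSort w i = |u (π i)| := h2 _ (hθ0 i hi)
    linarith
  have hhead : ∑ i : Fin d, (if (i : ℕ) < s then lam (i + 1) * |u (π i)| else 0) ≤
      ∑ i : Fin d, (if (i : ℕ) < s then lam (i + 1) * decSort (fun l => |u l|) i else 0) := by
    have ha : Antitone fun i : Fin d => if (i : ℕ) < s then lam (i + 1) else 0 := by
      intro i j hij
      have hij' : (i : ℕ) ≤ j := hij
      by_cases hj : (j : ℕ) < s
      · simp only [hj, lt_of_le_of_lt hij' hj, if_true]
        exact h.anti hij
      · simp only [hj, if_false]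
        split_ifs
        · exact h.nonneg i
        · exact le_rfl
    have := sum_mul_perm_le_decSort ha (fun l => |u l|) π
    simpa only [ite_mul, zero_mul] using this
  have hsum := sum_perm_le_sortedL1 h (θ + u) π
  have hterm : ∑ i : Fin d, lam (i + 1) * |θ (π i)|
      - ∑ i : Fin d, (if (i : ℕ) < s then lam (i + 1) * |u (π i)| else 0)
      + (∑ i : Fin d, lam (i + 1) * decSort (fun l => |u l|) i
        - ∑ i : Fin d, (if (i : ℕ) < s then lam (i + 1) * decSort (fun l => |u l|) i else 0))
      ≤ ∑ i : Fin d, lam (i + 1) * |(θ + u) (π i)| := by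
    rw [← Finset.sum_sub_distrib, ← Finset.sum_sub_distrib, ← Finset.sum_add_distrib]
    refine Finset.sum_le_sum fun i _ => ?_
    have hl := h.nonneg i
    by_cases hi : (i : ℕ) < s
    · simp only [hi, if_true, sub_self, add_zero, PiLp.add_apply]
      rw [← mul_sub]
      refine mul_le_mul_of_nonneg_left ?_ hl
      have := abs_sub_abs_le_abs_sub (θ (π i)) (-u (π i))
      simpa using this
    · simp only [hi, if_false, PiLp.add_apply, hθ0 i (not_lt.mp hi), abs_zero, zero_add]
      have := mul_le_mul_of_nonneg_left (htail i (not_lt.mp hi)) hl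
      linarith
  rw [sortedL1_eq lam u]
  linarith

end sorted

/-! ### Deterministic bounds for the penalized estimator -/

section slope
variable {d : ℕ} {lam : ℕ → ℝ}

lemma sum_sq_eq_norm_sq (y u : EuclideanSpace ℝ (Fin d)) :
    ∑ i, (y i - u i) ^ 2 = ‖y - u‖ ^ 2 := by
  simp [EuclideanSpace.norm_sq_eq]

/-- The first order condition at a minimizer of the criterion. -/
lemma inner_le_of_isMinOn (h : IsWeight d lam) {y u : EuclideanSpace ℝ (Fin d)} {r : ℝ}
    (hr : 0 ≤ r) (hu : IsMinOn (slopeCriterion lam y r) Set.univ u)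
    (w : EuclideanSpace ℝ (Fin d)) :
    2 * inner ℝ (y - u) (w - u) ≤ r * (sortedL1 lam w - sortedL1 lam u) := by
  have key : ∀ t : ℝ, 0 < t → t ≤ 1 →
      2 * inner ℝ (y - u) (w - u) - t * ‖w - u‖ ^ 2 ≤ r * (sortedL1 lam w - sortedL1 lam u) := by
    intro t ht ht1
    have h1 := hu (Set.mem_univ ((1 - t) • u + t • w))
    simp only [Set.mem_ofPred_eq, slopeCriterion, sum_sq_eq_norm_sq] at h1
    have h2 := sortedL1_add_smul_le h u w (sub_nonneg.mpr ht1) ht.le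
    have h3 : y - ((1 - t) • u + t • w) = (y - u) - t • (w - u) := by module
    rw [h3, norm_sub_sq_real (y - u) (t • (w - u)), inner_smul_right, norm_smul, mul_pow,
      Real.norm_eq_abs, sq_abs] at h1
    have h4 := mul_le_mul_of_nonneg_left h2 hr
    have h5 : t * (2 * inner ℝ (y - u) (w - u) - t * ‖w - u‖ ^ 2) ≤
        t * (r * (sortedL1 lam w - sortedL1 lam u)) := by linarith
    exact le_of_mul_le_mul_left h5 ht
  by_contra! hlt
  set D := 2 * inner ℝ (y - u) (w - u) - r * (sortedL1 lam w - sortedL1 lam u) with hD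
  have hDpos : 0 < D := by linarith
  -- A step `t` with `t ‖w - u‖² < D` contradicts minimality.
  set t := min 1 (D / (2 * (‖w - u‖ ^ 2 + 1))) with ht
  have hq : 0 ≤ ‖w - u‖ ^ 2 := by positivity
  have htpos : 0 < t := lt_min one_pos (by positivity)
  have h6 := key t htpos (min_le_left _ _)
  have h7 : t * ‖w - u‖ ^ 2 ≤ D / 2 := by
    calc t * ‖w - u‖ ^ 2 ≤ (D / (2 * (‖w - u‖ ^ 2 + 1))) * (‖w - u‖ ^ 2 + 1) := by
          gcongr
          · exact min_le_right _ _
          · linarith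
      _ = D / 2 := by field_simp
  linarith

/-- The minimizer depends on the data and on the noise level in a Lipschitz way. -/
lemma norm_sub_le_of_isMinOn (h : IsWeight d lam) {y y' u u' : EuclideanSpace ℝ (Fin d)}
    {r r' : ℝ} (hr : 0 ≤ r) (hr' : 0 ≤ r') (hu : IsMinOn (slopeCriterion lam y r) Set.univ u)
    (hu' : IsMinOn (slopeCriterion lam y' r') Set.univ u') :
    ‖u - u'‖ ≤ ‖y - y'‖ + (∑ i : Fin d, lam (i + 1)) * |r - r'| := by
  set K := ∑ i : Fin d, lam (i + 1)
  have h1 := inner_le_of_isMinOn h hr hu u'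
  have h2 := inner_le_of_isMinOn h hr' hu' u
  have h3 : inner ℝ (y - u) (u' - u) + inner ℝ (y' - u') (u - u') =
      ‖u - u'‖ ^ 2 - inner ℝ (y - y') (u - u') := by
    have e : u' - u = -(u - u') := by abel
    rw [e, inner_neg_right, neg_add_eq_sub, ← inner_sub_left,
      show y' - u' - (y - u) = (u - u') - (y - y') by abel, inner_sub_left,
      real_inner_self_eq_norm_sq]
  have h4 := real_inner_le_norm (y - y') (u - u')
  have h5 : (r - r') * (sortedL1 lam u' - sortedL1 lam u) ≤ |r - r'| * (K * ‖u - u'‖) := by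
    refine (le_abs_self _).trans ?_
    rw [abs_mul]
    refine mul_le_mul_of_nonneg_left ?_ (abs_nonneg _)
    rw [abs_sub_le_iff]
    refine ⟨?_, sortedL1_sub_le h u u'⟩
    have := sortedL1_sub_le h u' u
    rwa [norm_sub_rev] at this
  have h6 : ‖u - u'‖ * (2 * ‖u - u'‖) ≤ ‖u - u'‖ * (2 * ‖y - y'‖ + |r - r'| * K) := by
    linarith
  have hK : 0 ≤ |r - r'| * K := mul_nonneg (abs_nonneg _) (Finset.sum_nonneg fun i _ => h.nonneg i)
  rcases (norm_nonneg (u - u')).eq_or_lt with h0 | h0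
  · rw [← h0]; linarith [norm_nonneg (y - y')]
  · have := le_of_mul_le_mul_left h6 h0
    linarith [norm_nonneg (y - y')]

/-- The estimator is measurable: by the Lipschitz bound it is the restriction of a continuous
function of `(y, √V)` to the graph of `√V`. -/
lemma measurable_of_isSlopeEstimator (h : IsWeight d lam) {V : EuclideanSpace ℝ (Fin d) → ℝ}
    (hV : Measurable V) {θhat : EuclideanSpace ℝ (Fin d) → EuclideanSpace ℝ (Fin d)}
    (hθ : IsSlopeEstimator lam V θhat) : Measurable θhat := by
  set K := ∑ i : Fin d, lam (i + 1)
  have hK : 0 ≤ K := Finset.sum_nonneg fun i _ => h.nonneg i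
  set Φ : EuclideanSpace ℝ (Fin d) → EuclideanSpace ℝ (Fin d) × ℝ :=
    fun y => (y, Real.sqrt (V y))
  have hΦ : Measurable Φ := measurable_id.prodMk hV.sqrt
  have hlip : LipschitzOnWith (1 + K.toNNReal) (fun p : EuclideanSpace ℝ (Fin d) × ℝ => θhat p.1)
      (Set.range Φ) := by
    refine LipschitzOnWith.of_dist_le_mul ?_
    rintro _ ⟨y, rfl⟩ _ ⟨y', rfl⟩
    have h1 := norm_sub_le_of_isMinOn h (Real.sqrt_nonneg _) (Real.sqrt_nonneg _) (hθ y) (hθ y')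
    have h2 : ‖y - y'‖ ≤ dist (Φ y) (Φ y') := by
      rw [← dist_eq_norm]; exact le_max_left _ _
    have h3 : |Real.sqrt (V y) - Real.sqrt (V y')| ≤ dist (Φ y) (Φ y') := by
      rw [← Real.dist_eq]; exact le_max_right _ _
    rw [dist_eq_norm]
    push_cast
    rw [Real.coe_toNNReal _ hK]
    have := mul_le_mul_of_nonneg_left h3 hK
    linarith
  obtain ⟨g, hg, hgeq⟩ := hlip.extend_finite_dimension
  have : θhat = g ∘ Φ := by
    funext y
    exact hgeq ⟨y, rfl⟩
  rw [this]
  exact hg.continuous.measurable.comp hΦ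

lemma sum_decSort_abs_sq (u : EuclideanSpace ℝ (Fin d)) :
    ∑ i, decSort (fun l => |u l|) i ^ 2 = ‖u‖ ^ 2 := by
  rw [sum_comp_decSort (fun l => |u l|) (fun t => t ^ 2)]
  simp [EuclideanSpace.norm_sq_eq]

/-- A real number with `x ^ 2 ≤ a x + b x` satisfies `x ^ 2 ≤ 2 a ^ 2 + 2 b ^ 2`. -/
lemma sq_le_of_sq_le_add {x a b : ℝ} (h : x ^ 2 ≤ a * x + b * x) :
    x ^ 2 ≤ 2 * a ^ 2 + 2 * b ^ 2 := by
  nlinarith [sq_nonneg (a - b), sq_nonneg (x - a - b)]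

/-- The oracle inequality. The error is controlled by the part of the sorted noise that exceeds
the weights, and by the `s` largest weights. -/
lemma norm_sq_le_of_isMinOn (h : IsWeight d lam) {s : ℕ} {θ u z : EuclideanSpace ℝ (Fin d)}
    {r : ℝ} (hr : 0 ≤ r) (hs : sparsity θ ≤ s)
    (hu : IsMinOn (slopeCriterion lam (θ + z) r) Set.univ u) :
    ‖u - θ‖ ^ 2 ≤
      2 * ∑ i : Fin d, (max (2 * decSort (fun l => |z l|) i - r * lam (i + 1)) 0) ^ 2
      + 8 * r ^ 2 * ∑ i : Fin d, (if (i : ℕ) < s then lam (i + 1) ^ 2 else 0) := by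
  set e := u - θ with he
  set D := decSort fun l => |e l| with hDdef
  have hD0 : ∀ i, 0 ≤ D i := fun i => by rw [hDdef, decSort_eq]; exact abs_nonneg _
  have hDsq : ∑ i, D i ^ 2 = ‖e‖ ^ 2 := sum_decSort_abs_sq e
  have h1 := inner_le_of_isMinOn h hr hu θ
  have e1 : θ + z - u = z - e := by rw [he]; abel
  have e2 : θ - u = -e := by rw [he]; abel
  rw [e1, e2, inner_neg_right, inner_sub_left, real_inner_self_eq_norm_sq] at h1
  have h2 := sortedL1_sub_le_of_sparse h θ e hs
  rw [show θ + e = u by rw [he]; abel] at h2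
  have h3 : inner ℝ z e ≤ ∑ i, decSort (fun l => |z l|) i * D i := by
    have h4 := sum_mul_perm_le_decSort (decSort_antitone fun l => |z l|) (fun l => |e l|)
      (decPerm fun l => |z l|)
    refine le_trans ?_ h4
    simp only [decSort_eq]
    rw [Equiv.sum_comp (decPerm fun l => |z l|) (fun i => |z i| * |e i|), PiLp.inner_apply]
    refine Finset.sum_le_sum fun i _ => ?_
    rw [← abs_mul]
    refine (le_of_eq ?_).trans (le_abs_self _)
    simp [mul_comm]
  have h5 := mul_le_mul_of_nonneg_left h2 hr
  rw [sortedL1_eq lam e] at h5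
  set A := Real.sqrt (∑ i : Fin d, (max (2 * decSort (fun l => |z l|) i - r * lam (i + 1)) 0) ^ 2)
    with hA
  set Bq := ∑ i : Fin d, (if (i : ℕ) < s then lam (i + 1) ^ 2 else 0) with hB
  have hA2 : A ^ 2 =
      ∑ i : Fin d, (max (2 * decSort (fun l => |z l|) i - r * lam (i + 1)) 0) ^ 2 :=
    Real.sq_sqrt (Finset.sum_nonneg fun i _ => sq_nonneg _)
  have hBq : 0 ≤ Bq := Finset.sum_nonneg fun i _ => by split_ifs <;> positivity
  have hB2 : Real.sqrt Bq ^ 2 = Bq := Real.sq_sqrt hBq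
  have h6 : ∑ i : Fin d, (2 * decSort (fun l => |z l|) i - r * lam (i + 1)) * D i ≤ A * ‖e‖ := by
    calc _ ≤ ∑ i : Fin d, max (2 * decSort (fun l => |z l|) i - r * lam (i + 1)) 0 * D i :=
          Finset.sum_le_sum fun i _ => mul_le_mul_of_nonneg_right (le_max_left _ _) (hD0 i)
      _ ≤ A * Real.sqrt (∑ i, D i ^ 2) := Real.sum_mul_le_sqrt_mul_sqrt _ _ _
      _ = A * ‖e‖ := by rw [hDsq, Real.sqrt_sq (norm_nonneg _)]
  have h7 : ∑ i : Fin d, (if (i : ℕ) < s then lam (i + 1) * D i else 0) ≤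
      Real.sqrt Bq * ‖e‖ := by
    calc _ = ∑ i : Fin d, (if (i : ℕ) < s then lam (i + 1) else 0) * D i := by
          simp only [ite_mul, zero_mul]
      _ ≤ Real.sqrt (∑ i : Fin d, (if (i : ℕ) < s then lam (i + 1) else 0) ^ 2) *
            Real.sqrt (∑ i, D i ^ 2) := Real.sum_mul_le_sqrt_mul_sqrt _ _ _
      _ = Real.sqrt Bq * ‖e‖ := by
          rw [hDsq, Real.sqrt_sq (norm_nonneg _), hB]
          simp
  have h8 : ∑ i : Fin d, (2 * decSort (fun l => |z l|) i - r * lam (i + 1)) * D i =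
      2 * ∑ i, decSort (fun l => |z l|) i * D i - r * ∑ i : Fin d, lam (i + 1) * D i := by
    rw [Finset.mul_sum, Finset.mul_sum, ← Finset.sum_sub_distrib]
    exact Finset.sum_congr rfl fun i _ => by ring
  have h7' := mul_le_mul_of_nonneg_left h7 hr
  have h9 : ‖e‖ ^ 2 ≤ A * ‖e‖ + (2 * r * Real.sqrt Bq) * ‖e‖ := by
    nlinarith [sq_nonneg ‖e‖]
  have h10 := sq_le_of_sq_le_add h9
  rw [hA2, mul_pow, hB2] at h10
  linarith

end slope

/-! ### The median of block means -/

section median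

/-- With fewer than a quarter of the indices discarded, a median is bounded by the sum of the
remaining values. -/
lemma IsMedian.le_sum {m : ℕ} {v : Fin m → ℝ} {x : ℝ} (h : IsMedian v x) (hv : ∀ i, 0 ≤ v i)
    {S : Finset (Fin m)} (hS : 4 * S.card < m) : x ≤ 4 / m * ∑ i ∈ Sᶜ, v i := by
  have hm : (0 : ℝ) < m := by exact_mod_cast (by omega : 0 < m)
  have h0 : 0 ≤ ∑ i ∈ Sᶜ, v i := Finset.sum_nonneg fun i _ => hv i
  rcases le_or_gt x 0 with hx | hx
  · exact hx.trans (by positivity)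
  set F := Finset.univ.filter fun i => x ≤ v i
  have h1 : m ≤ 4 * (F \ S).card := by
    have h2 : m ≤ 2 * F.card := h.2
    have h3 : F.card - S.card ≤ (F \ S).card := Finset.le_card_sdiff S F
    omega
  have h4 : ((F \ S).card : ℝ) * x ≤ ∑ i ∈ Sᶜ, v i := by
    rw [← nsmul_eq_mul]
    refine (Finset.card_nsmul_le_sum (F \ S) v x fun i hi => ?_).trans ?_
    · exact (Finset.mem_filter.mp (Finset.mem_sdiff.mp hi).1).2
    · exact Finset.sum_le_sum_of_subset_of_nonneg
        (fun i hi => Finset.mem_compl.mpr (Finset.mem_sdiff.mp hi).2) fun i _ _ => hv i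
  have h5 : (m : ℝ) ≤ 4 * ((F \ S).card : ℝ) := by exact_mod_cast h1
  rw [div_mul_eq_mul_div, le_div_iff₀ hm]
  nlinarith

lemma IsMedian.card_lt {m : ℕ} {v : Fin m → ℝ} {x t : ℝ} (h : IsMedian v x) (hx : x < t)
    {S : Finset (Fin m)} (hS : 4 * S.card < m) :
    m ≤ 4 * ((Finset.univ.filter fun i => v i < t) \ S).card := by
  have h1 : (Finset.univ.filter fun i => v i ≤ x).card ≤
      (Finset.univ.filter fun i => v i < t).card := by
    refine Finset.card_le_card fun i hi => ?_
    simp only [Finset.mem_filter, Finset.mem_univ, true_and] at hi ⊢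
    exact hi.trans_lt hx
  have h2 := h.1
  have h3 := Finset.le_card_sdiff S (Finset.univ.filter fun i => v i < t)
  omega

/-- The blocks that meet the support of `θ`. -/
noncomputable def dirtyBlocks {d m : ℕ} (B : Fin m → Finset (Fin d))
    (θ : EuclideanSpace ℝ (Fin d)) : Finset (Fin m) :=
  letI := Classical.decPred fun i => ∃ j ∈ B i, θ j ≠ 0
  Finset.univ.filter fun i => ∃ j ∈ B i, θ j ≠ 0

lemma mem_dirtyBlocks {d m : ℕ} {B : Fin m → Finset (Fin d)} {θ : EuclideanSpace ℝ (Fin d)}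
    {i : Fin m} : i ∈ dirtyBlocks B θ ↔ ∃ j ∈ B i, θ j ≠ 0 := by
  simp [dirtyBlocks]

lemma card_dirtyBlocks_le {d m : ℕ} {B : Fin m → Finset (Fin d)} (hB : IsBlockDivision B)
    (θ : EuclideanSpace ℝ (Fin d)) : (dirtyBlocks B θ).card ≤ sparsity θ := by
  refine Finset.card_le_card_of_forall_subsingleton (fun i j => j ∈ B i) (fun i hi => ?_)
    fun j _ i hi i' hi' => ?_
  · obtain ⟨j, hj, hne⟩ := mem_dirtyBlocks.mp hi
    exact ⟨j, by simpa using hne, hj⟩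
  · by_contra hne
    exact Finset.disjoint_left.mp (hB.disjoint i i' hne) hi.2 hi'.2

end median

/-! ### Sums of independent variables -/

section prob
variable {d : ℕ} {P : Measure ℝ} [IsProbabilityMeasure P]

lemma memLp_comp_eval {f : ℝ → ℝ} (hf : MemLp f 2 P) (i : Fin d) :
    MemLp (fun ξ : Fin d → ℝ => f (ξ i)) 2 (Measure.pi fun _ : Fin d => P) :=
  hf.comp_measurePreserving (measurePreserving_eval (fun _ : Fin d => P) i)

lemma integrable_comp_eval' {f : ℝ → ℝ} (hf : Integrable f P) (i : Fin d) :
    Integrable (fun ξ : Fin d → ℝ => f (ξ i)) (Measure.pi fun _ : Fin d => P) :=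
  (measurePreserving_eval (fun _ : Fin d => P) i).integrable_comp_of_integrable hf

lemma integral_sum_eval {f : ℝ → ℝ} (hf : Integrable f P) (S : Finset (Fin d)) :
    ∫ ξ, ∑ i ∈ S, f (ξ i) ∂(Measure.pi fun _ : Fin d => P) = S.card * ∫ x, f x ∂P := by
  rw [integral_finsetSum _ fun i _ => integrable_comp_eval' hf i]
  have : ∀ i : Fin d, ∫ ξ, f (ξ i) ∂(Measure.pi fun _ : Fin d => P) = ∫ x, f x ∂P := fun i =>
    integral_comp_eval (μ := fun _ : Fin d => P) (i := i) hf.aestronglyMeasurable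
  simp [this]

lemma iIndepFun_eval : iIndepFun (fun (i : Fin d) (ξ : Fin d → ℝ) => ξ i)
    (Measure.pi fun _ : Fin d => P) :=
  iIndepFun_pi (X := fun _ x => x) fun _ => aemeasurable_id

lemma memLp_sum_eval {f : ℝ → ℝ} (hf : MemLp f 2 P) (S : Finset (Fin d)) :
    MemLp (fun ξ : Fin d → ℝ => ∑ i ∈ S, f (ξ i)) 2 (Measure.pi fun _ : Fin d => P) :=
  memLp_finsetSum S fun i _ => memLp_comp_eval hf i

lemma variance_sum_eval_le {f : ℝ → ℝ} (hfm : Measurable f) (hf : MemLp f 2 P)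
    (S : Finset (Fin d)) :
    Var[fun ξ => ∑ i ∈ S, f (ξ i); Measure.pi fun _ : Fin d => P] ≤ S.card * ∫ x, f x ^ 2 ∂P := by
  set μ := Measure.pi fun _ : Fin d => P with hμ
  have h1 : Var[∑ i ∈ S, fun ξ : Fin d → ℝ => f (ξ i); μ] =
      ∑ i ∈ S, Var[fun ξ : Fin d → ℝ => f (ξ i); μ] := by
    refine IndepFun.variance_sum (fun i _ => memLp_comp_eval hf i) fun i _ j _ hij => ?_
    exact (iIndepFun_eval.indepFun hij).comp hfm hfm
  have h2 : (∑ i ∈ S, fun ξ : Fin d → ℝ => f (ξ i)) = fun ξ => ∑ i ∈ S, f (ξ i) := by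
    ext ξ; simp
  rw [← h2, h1, ← nsmul_eq_mul]
  refine Finset.sum_le_card_nsmul _ _ _ fun i _ => ?_
  refine (variance_le_expectation_sq (memLp_comp_eval hf i).aestronglyMeasurable).trans ?_
  refine le_of_eq ?_
  exact integral_comp_eval (μ := fun _ : Fin d => P) (i := i) (f := fun x => f x ^ 2)
    (hf.aestronglyMeasurable.pow 2)

/-- The squared excess of a normalized sum over a level above its mean is at most its variance. -/
lemma integral_excess_sq_le {f : ℝ → ℝ} (hfm : Measurable f) (hf : MemLp f 2 P) {k t : ℝ}
    (hk : 0 < k) (ht : d * ∫ x, f x ∂P ≤ k * t) :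
    Integrable (fun ξ : Fin d → ℝ => (max ((∑ i, f (ξ i)) / k - t) 0) ^ 2)
      (Measure.pi fun _ : Fin d => P) ∧
    ∫ ξ : Fin d → ℝ, (max ((∑ i, f (ξ i)) / k - t) 0) ^ 2 ∂(Measure.pi fun _ : Fin d => P) ≤
      d / k ^ 2 * ∫ x, f x ^ 2 ∂P := by
  set μ := Measure.pi fun _ : Fin d => P with hμ
  set W : (Fin d → ℝ) → ℝ := fun ξ => ∑ i, f (ξ i) with hW
  have hWL : MemLp W 2 μ := memLp_sum_eval hf Finset.univ
  have hmean : ∫ ξ, W ξ ∂μ = d * ∫ x, f x ∂P := by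
    have := integral_sum_eval (d := d) (hf.integrable one_le_two) Finset.univ
    simpa using this
  have hvar : Var[W; μ] ≤ d * ∫ x, f x ^ 2 ∂P := by
    have := variance_sum_eval_le (d := d) hfm hf Finset.univ
    simpa using this
  have hWm : Measurable W := Finset.measurable_sum _ fun i _ => hfm.comp (measurable_pi_apply i)
  have hdom : Integrable (fun ξ => (W ξ - ∫ ξ', W ξ' ∂μ) ^ 2) μ :=
    (hWL.sub (memLp_const _)).integrable_sq
  have hle : ∀ ξ, (max (W ξ / k - t) 0) ^ 2 ≤ (W ξ - ∫ ξ', W ξ' ∂μ) ^ 2 / k ^ 2 := by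
    intro ξ
    rw [← div_pow, sq_le_sq]
    rw [abs_of_nonneg (le_max_right _ _)]
    refine max_le ?_ (abs_nonneg _)
    refine le_trans ?_ (le_abs_self _)
    rw [sub_div, hmean]
    have : (d * ∫ x, f x ∂P) / k ≤ t := by rwa [div_le_iff₀' hk]
    linarith
  have hint : Integrable (fun ξ => (max (W ξ / k - t) 0) ^ 2) μ := by
    refine (hdom.div_const (k ^ 2)).mono' (by fun_prop) (ae_of_all _ fun ξ => ?_)
    rw [Real.norm_of_nonneg (sq_nonneg _)]
    exact hle ξ
  refine ⟨hint, (integral_mono hint (hdom.div_const _) hle).trans ?_⟩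
  rw [integral_div, ← variance_eq_integral hWm.aemeasurable, div_mul_eq_mul_div]
  gcongr

/-- The mean of `min (ξ_j²) L` over a block. -/
noncomputable def truncMean (L : ℝ) (S : Finset (Fin d)) (ξ : Fin d → ℝ) : ℝ :=
  (∑ j ∈ S, min (ξ j ^ 2) L) / S.card

lemma measurable_truncMean (L : ℝ) (S : Finset (Fin d)) : Measurable (truncMean L S) := by
  unfold truncMean
  fun_prop

/-- A lower deviation bound for a single block, by truncation and Chebyshev's inequality. -/
lemma measureReal_truncMean_lt_le {L : ℝ} (hL : 0 ≤ L) (hi : Integrable (fun x : ℝ => x ^ 2) P)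
    (h1 : ∫ x, x ^ 2 ∂P = 1) (h34 : 3 / 4 ≤ ∫ x, min (x ^ 2) L ∂P) {S : Finset (Fin d)}
    (hS : 128 * L ≤ S.card) (hS0 : 0 < S.card) :
    (Measure.pi fun _ : Fin d => P).real {ξ | truncMean L S ξ < 1 / 2} ≤ 1 / 8 := by
  set μ := Measure.pi fun _ : Fin d => P with hμ
  set f : ℝ → ℝ := fun x => min (x ^ 2) L with hf
  have hfm : Measurable f := by fun_prop
  have hf0 : ∀ x, 0 ≤ f x := fun x => le_min (sq_nonneg x) hL
  have hfL : MemLp f 2 P := by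
    refine MemLp.of_bound hfm.aestronglyMeasurable L (ae_of_all _ fun x => ?_)
    rw [Real.norm_of_nonneg (hf0 x)]
    exact min_le_right _ _
  have hf2 : ∫ x, f x ^ 2 ∂P ≤ L := by
    calc ∫ x, f x ^ 2 ∂P ≤ ∫ x, L * x ^ 2 ∂P := by
          refine integral_mono hfL.integrable_sq (hi.const_mul L) fun x => ?_
          rw [pow_two]
          exact mul_le_mul (min_le_right _ _) (min_le_left _ _) (hf0 x) hL
      _ = L := by rw [integral_const_mul, h1, mul_one]
  have hn : (0 : ℝ) < S.card := by exact_mod_cast hS0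
  set W : (Fin d → ℝ) → ℝ := fun ξ => ∑ j ∈ S, f (ξ j) with hW
  have hWL : MemLp W 2 μ := memLp_sum_eval hfL S
  have hmean : ∫ ξ, W ξ ∂μ = S.card * ∫ x, f x ∂P :=
    integral_sum_eval (hfL.integrable one_le_two) S
  have hvar : Var[W; μ] ≤ S.card * L :=
    (variance_sum_eval_le hfm hfL S).trans (by gcongr)
  have hc : (0 : ℝ) < S.card / 4 := by positivity
  have hcheb := meas_ge_le_variance_div_sq hWL hc
  have hsub : {ξ | truncMean L S ξ < 1 / 2} ⊆ {ξ | (S.card : ℝ) / 4 ≤ |W ξ - ∫ ξ', W ξ' ∂μ|} := by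
    intro ξ hξ
    simp only [Set.mem_ofPred_eq, truncMean, div_lt_iff₀ hn] at hξ ⊢
    rw [hmean]
    have h2 : (S.card : ℝ) * (3 / 4) ≤ S.card * ∫ x, f x ∂P := by gcongr
    have h3 : W ξ < 1 / 2 * S.card := hξ
    rw [abs_sub_comm]
    refine le_trans ?_ (le_abs_self _)
    linarith
  rw [Measure.real]
  refine ENNReal.toReal_le_of_le_ofReal (by norm_num) ((measure_mono hsub).trans (hcheb.trans ?_))
  refine ENNReal.ofReal_le_ofReal ?_
  rw [div_le_iff₀ (by positivity)]
  nlinarith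

open Classical in
/-- Few blocks have an unusually small truncated mean, since the blocks are independent. -/
lemma measureReal_card_truncMean_le {L : ℝ} {m : ℕ} (hm : 0 < m)
    {B : Fin m → Finset (Fin d)} (hB : ∀ i j, i ≠ j → Disjoint (B i) (B j))
    (h8 : ∀ i, (Measure.pi fun _ : Fin d => P).real {ξ | truncMean L (B i) ξ < 1 / 2} ≤ 1 / 8) :
    MeasurableSet {ξ : Fin d → ℝ |
      m ≤ 4 * (Finset.univ.filter fun i => truncMean L (B i) ξ < 1 / 2).card} ∧
    (Measure.pi fun _ : Fin d => P).real {ξ |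
      m ≤ 4 * (Finset.univ.filter fun i => truncMean L (B i) ξ < 1 / 2).card} ≤ 8 / m := by
  set μ := Measure.pi fun _ : Fin d => P with hμ
  have hmR : (0 : ℝ) < m := by exact_mod_cast hm
  set Z : Fin m → (Fin d → ℝ) → ℝ := fun i =>
    Set.indicator {ξ | truncMean L (B i) ξ < 1 / 2} fun _ => 1 with hZ
  have hset : ∀ i, MeasurableSet {ξ : Fin d → ℝ | truncMean L (B i) ξ < 1 / 2} := fun i =>
    measurableSet_lt (measurable_truncMean L (B i)) measurable_const
  have hZm : ∀ i, Measurable (Z i) := fun i => measurable_const.indicator (hset i)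
  have hZint : ∀ i, ∫ ξ, Z i ξ ∂μ ≤ 1 / 8 := by
    intro i
    rw [hZ, integral_indicator_const _ (hset i)]
    simpa using h8 i
  have hZb : ∀ i ξ, ‖Z i ξ‖ ≤ 1 := by
    intro i ξ
    simp only [hZ, Set.indicator_apply]
    split_ifs <;> simp
  have hZL : ∀ i, MemLp (Z i) 2 μ := fun i =>
    MemLp.of_bound (hZm i).aestronglyMeasurable 1 (ae_of_all _ (hZb i))
  have hZsq : ∀ i, (Z i) ^ 2 = Z i := by
    intro i
    ext ξ
    simp only [Pi.pow_apply, hZ, Set.indicator_apply]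
    split_ifs <;> simp
  have hvarZ : ∀ i, Var[Z i; μ] ≤ 1 / 8 := by
    intro i
    refine (variance_le_expectation_sq (hZm i).aestronglyMeasurable).trans ?_
    rw [hZsq]
    exact hZint i
  have hind : ∀ i j, i ≠ j → IndepFun (Z i) (Z j) μ := by
    intro i j hij
    have h1 := (iIndepFun_eval (d := d) (P := P)).indepFun_finset (B i) (B j) (hB i j hij)
      fun l => measurable_pi_apply l
    set φ : ∀ i : Fin m, (B i → ℝ) → ℝ := fun i =>
      Set.indicator {x | (∑ l, min (x l ^ 2) L) / ((B i).card : ℝ) < 1 / 2} fun _ => 1 with hφ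
    have hφm : ∀ i, Measurable (φ i) := fun i =>
      measurable_const.indicator (measurableSet_lt (by fun_prop) measurable_const)
    have h2 := h1.comp (hφm i) (hφm j)
    have h3 : ∀ i, (φ i ∘ fun (ξ : Fin d → ℝ) (l : B i) => ξ l) = Z i := by
      intro i
      ext ξ
      simp only [hφ, hZ, Function.comp, Set.indicator_apply, Set.mem_ofPred_eq, truncMean,
        Finset.sum_coe_sort (B i) fun l => min (ξ l ^ 2) L]
    rwa [h3 i, h3 j] at h2
  set N : (Fin d → ℝ) → ℝ := fun ξ => ∑ i, Z i ξ with hN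
  have hNL : MemLp N 2 μ := memLp_finsetSum _ fun i _ => hZL i
  have hNvar : Var[N; μ] ≤ m / 8 := by
    have h2 : (∑ i, Z i) = N := by ext ξ; simp [hN]
    rw [← h2, IndepFun.variance_sum (fun i _ => hZL i) fun i _ j _ hij => hind i j hij]
    calc ∑ i, Var[Z i; μ] ≤ ∑ _i : Fin m, (1 / 8 : ℝ) := Finset.sum_le_sum fun i _ => hvarZ i
      _ = m / 8 := by simp; ring
  have hNmean : ∫ ξ, N ξ ∂μ ≤ m / 8 := by
    rw [hN, integral_finsetSum _ fun i _ => (hZL i).integrable one_le_two]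
    calc ∑ i, ∫ ξ, Z i ξ ∂μ ≤ ∑ _i : Fin m, (1 / 8 : ℝ) := Finset.sum_le_sum fun i _ => hZint i
      _ = m / 8 := by simp; ring
  have hNcard : ∀ ξ, N ξ = (Finset.univ.filter fun i => truncMean L (B i) ξ < 1 / 2).card := by
    intro ξ
    simp [hN, hZ, Set.indicator_apply]
  have hNm : Measurable N := Finset.measurable_sum _ fun i _ => hZm i
  have hEq : {ξ : Fin d → ℝ |
      m ≤ 4 * (Finset.univ.filter fun i => truncMean L (B i) ξ < 1 / 2).card} =
      {ξ | (m : ℝ) ≤ 4 * N ξ} := by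
    ext ξ
    simp only [Set.mem_ofPred_eq, hNcard]
    exact_mod_cast Iff.rfl
  rw [hEq]
  refine ⟨measurableSet_le measurable_const (hNm.const_mul 4), ?_⟩
  have hcheb := meas_ge_le_variance_div_sq hNL (c := (m : ℝ) / 8) (by positivity)
  rw [Measure.real]
  refine ENNReal.toReal_le_of_le_ofReal (by positivity)
    ((measure_mono fun ξ hξ => ?_).trans (hcheb.trans (ENNReal.ofReal_le_ofReal ?_)))
  · simp only [Set.mem_ofPred_eq] at hξ ⊢
    refine le_trans ?_ (le_abs_self _)
    linarith
  · rw [div_le_div_iff₀ (by positivity) hmR]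
    nlinarith

end prob

/-! ### The risk bound for general weights -/

section risk
variable {d m s : ℕ} {T : ℕ → ℝ}

/-- The block mean of the squared noise. -/
noncomputable def noiseMean (S : Finset (Fin d)) (ξ : Fin d → ℝ) : ℝ :=
  (∑ j ∈ S, ξ j ^ 2) / S.card

lemma noiseMean_nonneg (S : Finset (Fin d)) (ξ : Fin d → ℝ) : 0 ≤ noiseMean S ξ :=
  div_nonneg (Finset.sum_nonneg fun _ _ => sq_nonneg _) (Nat.cast_nonneg _)

lemma truncMean_le_noiseMean (L : ℝ) (S : Finset (Fin d)) (ξ : Fin d → ℝ) :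
    truncMean L S ξ ≤ noiseMean S ξ :=
  div_le_div_of_nonneg_right (Finset.sum_le_sum fun _ _ => min_le_left _ _) (Nat.cast_nonneg _)

/-- The positive part of the excess over `t` of the normalized sum of `(|ξ_l| - 2 t)_+`. It
controls the excess over `3 t` of the `k`-th largest `|ξ_l|`. -/
noncomputable def excess (t k : ℝ) (ξ : Fin d → ℝ) : ℝ :=
  max ((∑ l, max (|ξ l| - 2 * t) 0) / k - t) 0

lemma decSort_abs_mul_le {σ : ℝ} (hσ : 0 < σ) (t : ℝ) (ξ : Fin d → ℝ) (i : Fin d) :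
    decSort (fun l => |σ * ξ l|) i ≤
      σ * (3 * t + ((∑ l, max (|ξ l| - 2 * t) 0) / (i + 1) - t)) := by
  have h1 := decSort_le_average (fun l => |σ * ξ l|) (f := fun x => max (x - 2 * (σ * t)) 0)
    (fun a b hab => by dsimp only; gcongr) (fun _ => le_max_right _ _) i
  have h2 : ∀ l, max (|σ * ξ l| - 2 * (σ * t)) 0 = σ * max (|ξ l| - 2 * t) 0 := by
    intro l
    rw [abs_mul, abs_of_pos hσ, mul_max_of_nonneg _ _ hσ.le, mul_zero]
    congr 1
    ring
  simp only [h2, ← Finset.mul_sum] at h1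
  have h3 := (le_max_left _ _).trans h1
  rw [mul_div_assoc] at h3
  linarith

open Classical in
/-- The event that many blocks have an unusually small truncated mean. -/
def lowEvent (L : ℝ) (B : Fin m → Finset (Fin d)) : Set (Fin d → ℝ) :=
  {ξ | m ≤ 4 * (Finset.univ.filter fun i => truncMean L (B i) ξ < 1 / 2).card}

/-- The sum of the squares of `T 1, …, T s`, for `s ≤ d`. -/
noncomputable def headSq (d s : ℕ) (T : ℕ → ℝ) : ℝ :=
  ∑ i : Fin d, if (i : ℕ) < s then T (i + 1) ^ 2 else 0

/-- A measurable function of the noise that dominates the squared error: the excesses of the sorted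
noise, the failure of the noise level estimate, and the bias caused by the `s` largest weights. -/
noncomputable def errorBound (L σ : ℝ) (T : ℕ → ℝ) (s : ℕ) (B : Fin m → Finset (Fin d))
    (ξ : Fin d → ℝ) : ℝ :=
  16 * σ ^ 2 * ∑ i : Fin d, excess (T (i + 1)) (i + 1) ξ ^ 2
    + 144 * σ ^ 2 * (∑ i : Fin d, T (i + 1) ^ 2) * (lowEvent L B).indicator (fun _ => 1) ξ
    + 2592 * σ ^ 2 / m * headSq d s T * ∑ i, noiseMean (B i) ξ

lemma headSq_nonneg (d s : ℕ) (T : ℕ → ℝ) : 0 ≤ headSq d s T :=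
  Finset.sum_nonneg fun i _ => by split_ifs <;> positivity

section pointwise
variable {B : Fin m → Finset (Fin d)} {V : EuclideanSpace ℝ (Fin d) → ℝ}
  {θ : EuclideanSpace ℝ (Fin d)} {σ : ℝ} {ξ : Fin d → ℝ}

lemma blockMean_eq_of_clean {i : Fin m} (hi : i ∉ dirtyBlocks B θ) :
    blockMean (B i) (WithLp.toLp 2 fun j => θ j + σ * ξ j) = σ ^ 2 * noiseMean (B i) ξ := by
  have h0 : ∀ j ∈ B i, θ j = 0 := by
    intro j hj
    by_contra hne
    exact hi (mem_dirtyBlocks.mpr ⟨j, hj, hne⟩)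
  rw [blockMean, noiseMean, mul_div_assoc', Finset.mul_sum]
  congr 1
  refine Finset.sum_congr rfl fun j hj => ?_
  simp [h0 j hj, mul_pow]

/-- At least a quarter of the blocks are free of signal and have a mean above the median, so the
median is at most four times the average of the noise means. -/
lemma sq_sqrt_median_le (hB : IsBlockDivision B) (hV : IsMedianOfMeans B V) (hs : 4 * s < m)
    (hθ : sparsity θ ≤ s) :
    Real.sqrt (V (WithLp.toLp 2 fun j => θ j + σ * ξ j)) ^ 2 ≤
      4 / m * (σ ^ 2 * ∑ i, noiseMean (B i) ξ) := by
  set y : EuclideanSpace ℝ (Fin d) := WithLp.toLp 2 fun j => θ j + σ * ξ j with hy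
  have hcard := card_dirtyBlocks_le hB θ
  have hsum : 0 ≤ ∑ i, noiseMean (B i) ξ := Finset.sum_nonneg fun i _ => noiseMean_nonneg _ _
  have h1 := (hV.2 y).le_sum (S := dirtyBlocks B θ)
    (fun i => div_nonneg (Finset.sum_nonneg fun _ _ => sq_nonneg _) (Nat.cast_nonneg _)) (by omega)
  rw [Real.sq_sqrt']
  refine max_le (h1.trans ?_) (by positivity)
  gcongr
  have h2 : ∀ i ∈ (dirtyBlocks B θ)ᶜ, blockMean (B i) y = σ ^ 2 * noiseMean (B i) ξ :=
    fun i hi => blockMean_eq_of_clean (Finset.mem_compl.mp hi)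
  rw [Finset.sum_congr rfl h2, ← Finset.mul_sum]
  exact mul_le_mul_of_nonneg_left (Finset.sum_le_sum_of_subset_of_nonneg (Finset.subset_univ _)
    fun i _ _ => noiseMean_nonneg _ _) (sq_nonneg σ)

/-- If the median underestimates `σ ^ 2` by a factor two, a quarter of the blocks are free of signal
and have a small noise mean. -/
lemma mem_lowEvent_of_median_lt (hB : IsBlockDivision B) (hV : IsMedianOfMeans B V)
    (hs : 4 * s < m) (hθ : sparsity θ ≤ s) (L : ℝ)
    (hlt : V (WithLp.toLp 2 fun j => θ j + σ * ξ j) < σ ^ 2 / 2) : ξ ∈ lowEvent L B := by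
  classical
  have hcard := card_dirtyBlocks_le hB θ
  have h1 := (hV.2 _).card_lt hlt (S := dirtyBlocks B θ) (by omega)
  refine h1.trans (Nat.mul_le_mul_left 4 (Finset.card_le_card fun i hi => ?_))
  obtain ⟨hi1, hi2⟩ := Finset.mem_sdiff.mp hi
  simp only [Finset.mem_filter, Finset.mem_univ, true_and] at hi1 ⊢
  rw [blockMean_eq_of_clean hi2] at hi1
  refine (truncMean_le_noiseMean L _ _).trans_lt ?_
  by_contra! hle
  have := mul_le_mul_of_nonneg_left hle (sq_nonneg σ)
  linarith

lemma norm_sq_le_errorBound (hT : IsWeight d T) (hB : IsBlockDivision B)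
    (hV : IsMedianOfMeans B V) {θhat : EuclideanSpace ℝ (Fin d) → EuclideanSpace ℝ (Fin d)}
    (hθhat : IsSlopeEstimator (fun j => 9 * T j) V θhat) (hs : 4 * s < m)
    (hθ : sparsity θ ≤ s) (hσ : 0 < σ) (L : ℝ) :
    ‖θhat (WithLp.toLp 2 fun j => θ j + σ * ξ j) - θ‖ ^ 2 ≤ errorBound L σ T s B ξ := by
  set y : EuclideanSpace ℝ (Fin d) := WithLp.toLp 2 fun j => θ j + σ * ξ j with hy
  set z : EuclideanSpace ℝ (Fin d) := WithLp.toLp 2 fun j => σ * ξ j with hz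
  have hyz : y = θ + z := by ext j; simp [hy, hz]
  set r := Real.sqrt (V y) with hr
  have hw : IsWeight d fun j => 9 * T j :=
    ⟨fun i j hij => mul_le_mul_of_nonneg_left (hT.anti hij) (by norm_num),
      fun i => mul_nonneg (by norm_num) (hT.nonneg i)⟩
  have h1 := norm_sq_le_of_isMinOn hw (Real.sqrt_nonneg _) hθ (hyz ▸ hθhat y)
  rw [← hyz, ← hr] at h1
  set I := (lowEvent L B).indicator (fun _ => (1 : ℝ)) ξ with hI
  have hI0 : 0 ≤ I := Set.indicator_nonneg (fun _ _ => zero_le_one) _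
  have hterm : ∀ i : Fin d,
      (max (2 * decSort (fun l => |z l|) i - r * (9 * T (i + 1))) 0) ^ 2 ≤
        8 * σ ^ 2 * excess (T (i + 1)) (i + 1) ξ ^ 2 + 72 * σ ^ 2 * I * T (i + 1) ^ 2 := by
    intro i
    have hTi := hT.nonneg i
    have hd : decSort (fun l => |z l|) i ≤ σ * (3 * T (i + 1) + excess (T (i + 1)) (i + 1) ξ) := by
      refine (decSort_abs_mul_le hσ (T (i + 1)) ξ i).trans ?_
      gcongr
      exact le_max_left _ _
    have he : 0 ≤ excess (T (i + 1)) (i + 1) ξ := le_max_right _ _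
    set e := excess (T (i + 1)) (i + 1) ξ
    rcases le_or_gt (σ ^ 2 / 2) (V y) with hg | hb
    -- `9 √V ≥ 6 σ` here, so the weights absorb the sorted noise up to three times the threshold.
    · have hr2 : 2 / 3 * σ ≤ r := Real.le_sqrt_of_sq_le (by nlinarith)
      have h2 : max (2 * decSort (fun l => |z l|) i - r * (9 * T (i + 1))) 0 ≤ 2 * σ * e := by
        refine max_le ?_ (by positivity)
        nlinarith [mul_le_mul_of_nonneg_right hr2 hTi]
      have h3 := pow_le_pow_left₀ (le_max_right _ _) h2 2
      have h4 : 0 ≤ 72 * σ ^ 2 * I * T (i + 1) ^ 2 := by positivity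
      nlinarith [sq_nonneg (σ * e)]
    · have hI1 : I = 1 := by
        rw [hI, Set.indicator_of_mem (mem_lowEvent_of_median_lt hB hV hs hθ L hb)]
      have hr0 : 0 ≤ r * (9 * T (i + 1)) := by positivity
      have h2 : max (2 * decSort (fun l => |z l|) i - r * (9 * T (i + 1))) 0 ≤
          2 * σ * (3 * T (i + 1) + e) := by
        refine max_le ?_ (by positivity)
        linarith
      have h3 := pow_le_pow_left₀ (le_max_right _ _) h2 2
      rw [hI1]
      refine h3.trans ?_
      have h4 : 0 ≤ σ ^ 2 * (3 * T (i + 1) - e) ^ 2 := by positivity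
      nlinarith
  have h5 : ∑ i : Fin d, (max (2 * decSort (fun l => |z l|) i - r * (9 * T (i + 1))) 0) ^ 2 ≤
      8 * σ ^ 2 * ∑ i : Fin d, excess (T (i + 1)) (i + 1) ξ ^ 2
        + 72 * σ ^ 2 * I * ∑ i : Fin d, T (i + 1) ^ 2 := by
    rw [Finset.mul_sum, Finset.mul_sum, ← Finset.sum_add_distrib]
    exact Finset.sum_le_sum fun i _ => hterm i
  have h6 : ∑ i : Fin d, (if (i : ℕ) < s then (9 * T (i + 1)) ^ 2 else 0) = 81 * headSq d s T := by
    rw [headSq, Finset.mul_sum]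
    refine Finset.sum_congr rfl fun i _ => ?_
    split_ifs <;> ring
  have h7 : r ^ 2 ≤ 4 / m * (σ ^ 2 * ∑ i, noiseMean (B i) ξ) := sq_sqrt_median_le hB hV hs hθ
  have h8 := mul_le_mul_of_nonneg_right h7 (headSq_nonneg d s T)
  rw [h6] at h1
  rw [errorBound]
  have h9 : 648 * (4 / m * (σ ^ 2 * ∑ i, noiseMean (B i) ξ) * headSq d s T) =
      2592 * σ ^ 2 / m * headSq d s T * ∑ i, noiseMean (B i) ξ := by ring
  linarith

end pointwise

section expectation

lemma memLp_excess {P : Measure ℝ} (hi : Integrable (fun x : ℝ => x ^ 2) P) {t : ℝ} (ht : 0 ≤ t) :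
    MemLp (fun x : ℝ => max (|x| - t) 0) 2 P := by
  have hid : MemLp (fun x : ℝ => x) 2 P :=
    (memLp_two_iff_integrable_sq aestronglyMeasurable_id).mpr hi
  refine hid.mono (by fun_prop) (ae_of_all _ fun x => ?_)
  rw [Real.norm_of_nonneg (le_max_right _ _), Real.norm_eq_abs]
  exact max_le (by linarith) (abs_nonneg x)

variable {P : Measure ℝ} [IsProbabilityMeasure P]

lemma integral_noiseMean_le (hi : Integrable (fun x : ℝ => x ^ 2) P) (h1 : ∫ x, x ^ 2 ∂P = 1)
    (S : Finset (Fin d)) :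
    Integrable (noiseMean S) (Measure.pi fun _ : Fin d => P) ∧
    ∫ ξ, noiseMean S ξ ∂(Measure.pi fun _ : Fin d => P) ≤ 1 := by
  refine ⟨(integrable_finsetSum S fun i _ => integrable_comp_eval' hi i).div_const _, ?_⟩
  simp only [noiseMean]
  rw [integral_div, integral_sum_eval hi, h1, mul_one]
  exact div_self_le_one _

/-- The mean excess over `2 t` is controlled by the mean squared excess over `t`. -/
lemma integral_excess_two_mul_le (hi : Integrable (fun x : ℝ => x ^ 2) P) {t : ℝ} (ht : 0 < t) :
    ∫ x : ℝ, max (|x| - 2 * t) 0 ∂P ≤ (∫ x : ℝ, (max (|x| - t) 0) ^ 2 ∂P) / t ∧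
    ∫ x : ℝ, (max (|x| - 2 * t) 0) ^ 2 ∂P ≤ ∫ x : ℝ, (max (|x| - t) 0) ^ 2 ∂P := by
  have hm1 := memLp_excess hi ht.le
  have hm2 := memLp_excess hi (t := 2 * t) (by positivity)
  refine ⟨?_, ?_⟩
  · rw [← integral_div]
    refine integral_mono (hm2.integrable one_le_two) (hm1.integrable_sq.div_const _) fun x => ?_
    dsimp only
    rw [le_div_iff₀ ht]
    rcases le_total (|x| - 2 * t) 0 with h | h
    · rw [max_eq_right h, zero_mul]
      positivity
    · rw [max_eq_left h, max_eq_left (by linarith)]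
      nlinarith [sq_nonneg (|x| - 2 * t - t)]
  · refine integral_mono hm2.integrable_sq hm1.integrable_sq fun x => ?_
    dsimp only
    refine pow_le_pow_left₀ (le_max_right _ _) ?_ 2
    gcongr
    linarith

/-- The risk bound for thresholds `T` such that the mean squared excess of the noise over
`T (i + 1)` is at most `v i`. -/
lemma integral_errorBound_le (hi : Integrable (fun x : ℝ => x ^ 2) P) (h1 : ∫ x, x ^ 2 ∂P = 1)
    {L σ : ℝ} (hL : 0 ≤ L) (h34 : 3 / 4 ≤ ∫ x, min (x ^ 2) L ∂P)
    (hTpos : ∀ i : Fin d, 0 < T (i + 1)) {v : Fin d → ℝ}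
    (hv : ∀ i : Fin d, ∫ x : ℝ, (max (|x| - T (i + 1)) 0) ^ 2 ∂P ≤ v i)
    (hvT : ∀ i : Fin d, d * v i ≤ (i + 1) * T (i + 1) ^ 2)
    {B : Fin m → Finset (Fin d)} (hB : IsBlockDivision B) (hm : 0 < m)
    (hcard : ∀ i, 128 * L ≤ (B i).card) (hcard0 : ∀ i, 0 < (B i).card) :
    Integrable (errorBound L σ T s B) (Measure.pi fun _ : Fin d => P) ∧
    ∫ ξ, errorBound L σ T s B ξ ∂(Measure.pi fun _ : Fin d => P) ≤
      σ ^ 2 * (16 * ∑ i : Fin d, d / ((i : ℝ) + 1) ^ 2 * v i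
        + 1152 / m * ∑ i : Fin d, T (i + 1) ^ 2 + 2592 * headSq d s T) := by
  classical
  set μ := Measure.pi fun _ : Fin d => P with hμ
  have hmR : (0 : ℝ) < m := by exact_mod_cast hm
  have hex : ∀ i : Fin d, Integrable (fun ξ => excess (T (i + 1)) (i + 1) ξ ^ 2) μ ∧
      ∫ ξ, excess (T (i + 1)) (i + 1) ξ ^ 2 ∂μ ≤ d / ((i : ℝ) + 1) ^ 2 * v i := by
    intro i
    have hT := hTpos i
    obtain ⟨e1, e2⟩ := integral_excess_two_mul_le hi hT
    have h2 : d * ∫ x, max (|x| - 2 * T (i + 1)) 0 ∂P ≤ ((i : ℝ) + 1) * T (i + 1) := by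
      calc d * ∫ x, max (|x| - 2 * T (i + 1)) 0 ∂P ≤ d * (v i / T (i + 1)) := by
            gcongr
            exact e1.trans (by gcongr; exact hv i)
        _ = d * v i / T (i + 1) := by ring
        _ ≤ (i + 1) * T (i + 1) ^ 2 / T (i + 1) := div_le_div_of_nonneg_right (hvT i) hT.le
        _ = ((i : ℝ) + 1) * T (i + 1) := by field_simp
    obtain ⟨e3, e4⟩ := integral_excess_sq_le (d := d) (f := fun x => max (|x| - 2 * T (i + 1)) 0)
      (by fun_prop) (memLp_excess hi (by positivity)) (k := (i : ℝ) + 1) (by positivity) h2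
    refine ⟨e3, e4.trans ?_⟩
    gcongr
    exact e2.trans (hv i)
  obtain ⟨hE, hPE⟩ := measureReal_card_truncMean_le (P := P) (L := L) hm hB.disjoint fun i =>
    measureReal_truncMean_lt_le hL hi h1 h34 (hcard i) (hcard0 i)
  change MeasurableSet (lowEvent L B) at hE
  change μ.real (lowEvent L B) ≤ 8 / m at hPE
  have hIint : Integrable ((lowEvent L B).indicator fun _ => (1 : ℝ)) μ :=
    (integrable_const 1).indicator hE
  have i1 : Integrable (fun ξ => 16 * σ ^ 2 * ∑ i : Fin d, excess (T (i + 1)) (i + 1) ξ ^ 2) μ :=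
    (integrable_finsetSum _ fun i _ => (hex i).1).const_mul _
  have i2 : Integrable (fun ξ => 144 * σ ^ 2 * (∑ i : Fin d, T (i + 1) ^ 2) *
      (lowEvent L B).indicator (fun _ => 1) ξ) μ := hIint.const_mul _
  have i3 : Integrable (fun ξ => 2592 * σ ^ 2 / m * headSq d s T * ∑ i, noiseMean (B i) ξ) μ :=
    (integrable_finsetSum _ fun i _ => (integral_noiseMean_le hi h1 (B i)).1).const_mul _
  have i12 : Integrable (fun ξ => 16 * σ ^ 2 * ∑ i : Fin d, excess (T (i + 1)) (i + 1) ξ ^ 2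
      + 144 * σ ^ 2 * (∑ i : Fin d, T (i + 1) ^ 2) *
        (lowEvent L B).indicator (fun _ => 1) ξ) μ := i1.add i2
  refine ⟨i12.add i3, ?_⟩
  have hsplit : ∫ ξ, errorBound L σ T s B ξ ∂μ =
      16 * σ ^ 2 * ∑ i : Fin d, ∫ ξ, excess (T (i + 1)) (i + 1) ξ ^ 2 ∂μ
      + 144 * σ ^ 2 * (∑ i : Fin d, T (i + 1) ^ 2) * μ.real (lowEvent L B)
      + 2592 * σ ^ 2 / m * headSq d s T * ∑ i, ∫ ξ, noiseMean (B i) ξ ∂μ := by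
    unfold errorBound
    rw [integral_add i12 i3, integral_add i1 i2, integral_const_mul, integral_const_mul,
      integral_const_mul, integral_finsetSum _ fun i _ => (hex i).1,
      integral_finsetSum _ fun i _ => (integral_noiseMean_le hi h1 (B i)).1,
      integral_indicator_const _ hE, smul_eq_mul, mul_one]
  have hnoise : ∑ i, ∫ ξ, noiseMean (B i) ξ ∂μ ≤ m := by
    calc ∑ i, ∫ ξ, noiseMean (B i) ξ ∂μ ≤ ∑ _i : Fin m, (1 : ℝ) :=
          Finset.sum_le_sum fun i _ => (integral_noiseMean_le hi h1 (B i)).2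
      _ = m := by simp
  have hH := headSq_nonneg d s T
  rw [hsplit]
  calc _ ≤ 16 * σ ^ 2 * ∑ i : Fin d, d / ((i : ℝ) + 1) ^ 2 * v i
        + 144 * σ ^ 2 * (∑ i : Fin d, T (i + 1) ^ 2) * (8 / m)
        + 2592 * σ ^ 2 / m * headSq d s T * m := by
        gcongr with i
        exact (hex i).2
    _ = _ := by field_simp; ring

/-- The risk bound in terms of the thresholds. -/
theorem slope_risk_le (hi : Integrable (fun x : ℝ => x ^ 2) P) (h1 : ∫ x, x ^ 2 ∂P = 1)
    {L σ : ℝ} (hL : 0 ≤ L) (h34 : 3 / 4 ≤ ∫ x, min (x ^ 2) L ∂P) (hT : IsWeight d T)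
    (hTpos : ∀ i : Fin d, 0 < T (i + 1)) {v : Fin d → ℝ}
    (hv : ∀ i : Fin d, ∫ x : ℝ, (max (|x| - T (i + 1)) 0) ^ 2 ∂P ≤ v i)
    (hvT : ∀ i : Fin d, d * v i ≤ (i + 1) * T (i + 1) ^ 2)
    {B : Fin m → Finset (Fin d)} (hB : IsBlockDivision B) (hs : 4 * s < m)
    (hcard : ∀ i, 128 * L ≤ (B i).card) (hcard0 : ∀ i, 0 < (B i).card)
    {V : EuclideanSpace ℝ (Fin d) → ℝ} (hV : IsMedianOfMeans B V)
    {θhat : EuclideanSpace ℝ (Fin d) → EuclideanSpace ℝ (Fin d)}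
    (hθhat : IsSlopeEstimator (fun j => 9 * T j) V θhat) {θ : EuclideanSpace ℝ (Fin d)}
    (hθ : sparsity θ ≤ s) (hσ : 0 < σ) :
    Integrable (fun y => ‖θhat y - θ‖ ^ 2) (obsLaw θ P σ) ∧
    ∫ y, ‖θhat y - θ‖ ^ 2 ∂(obsLaw θ P σ) ≤
      σ ^ 2 * (16 * ∑ i : Fin d, d / ((i : ℝ) + 1) ^ 2 * v i
        + 1152 / m * ∑ i : Fin d, T (i + 1) ^ 2 + 2592 * headSq d s T) := by
  have hw : IsWeight d fun j => 9 * T j :=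
    ⟨fun i j hij => mul_le_mul_of_nonneg_left (hT.anti hij) (by norm_num),
      fun i => mul_nonneg (by norm_num) (hT.nonneg i)⟩
  have hmeas : Measurable fun y => ‖θhat y - θ‖ ^ 2 :=
    ((measurable_of_isSlopeEstimator hw hV.1 hθhat).sub_const θ).norm.pow_const 2
  have hmap : Measurable fun ξ : Fin d → ℝ =>
      (WithLp.toLp 2 fun i => θ i + σ * ξ i : EuclideanSpace ℝ (Fin d)) := by
    refine (WithLp.measurable_toLp 2 _).comp ?_
    fun_prop
  obtain ⟨h2, h3⟩ := integral_errorBound_le (s := s) (σ := σ) hi h1 hL h34 hTpos hv hvT hB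
    (by omega) hcard hcard0
  have hint : Integrable (fun ξ : Fin d → ℝ =>
      ‖θhat (WithLp.toLp 2 fun i => θ i + σ * ξ i) - θ‖ ^ 2) (Measure.pi fun _ : Fin d => P) := by
    refine h2.mono' (hmeas.comp hmap).aestronglyMeasurable (ae_of_all _ fun ξ => ?_)
    rw [Real.norm_of_nonneg (sq_nonneg _)]
    exact norm_sq_le_errorBound hT hB hV hθhat hs hθ hσ L
  refine ⟨(integrable_map_measure hmeas.aestronglyMeasurable hmap.aemeasurable).mpr hint, ?_⟩
  rw [obsLaw, integral_map hmap.aemeasurable hmeas.aestronglyMeasurable]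
  exact (integral_mono hint h2 fun ξ =>
    norm_sq_le_errorBound hT hB hV hθhat hs hθ hσ L).trans h3

end expectation

end risk

/-! ### Truncated second moments under a power tail -/

/-- The tail of the law `P` is at most `A t ^ (-p)` beyond `T`. -/
def HasPowerTail (P : Measure ℝ) (A p T : ℝ) : Prop :=
  ∀ t : ℝ, T ≤ t → P.real {x | t < |x|} ≤ A * t ^ (-p)

lemma HasPowerTail.mono {P : Measure ℝ} {A p T T' : ℝ} (h : HasPowerTail P A p T) (hT : T ≤ T') :
    HasPowerTail P A p T' := fun t ht => h t (hT.trans ht)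

lemma HasPowerTail.mono_const {P : Measure ℝ} {A A' p T : ℝ} (h : HasPowerTail P A p T)
    (hA : A ≤ A') (hT : 0 ≤ T) : HasPowerTail P A' p T := fun t ht =>
  (h t ht).trans (mul_le_mul_of_nonneg_right hA (Real.rpow_nonneg (hT.trans ht) _))

lemma HasPowerTail.integral_sq_le {P : Measure ℝ} [IsProbabilityMeasure P] {A p T : ℝ}
    (h : HasPowerTail P A p T) (hA : 0 ≤ A) (hp : 2 < p) (hT : 0 < T) :
    ∫ x : ℝ, (max (|x| - T) 0) ^ 2 ∂P ≤ 2 * A / (p - 2) * T ^ (2 - p) := by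
  have hp2 : 0 < p - 2 := by linarith
  have hlc := lintegral_rpow_eq_lintegral_meas_lt_mul P (f := fun x : ℝ => max (|x| - T) 0)
    (ae_of_all _ fun x => le_max_right _ _) (by fun_prop) (p := 2) two_pos
  have hint : IntegrableOn (fun u : ℝ => A * u ^ (1 - p)) (Set.Ioi T) :=
    (integrableOn_Ioi_rpow_of_lt (by linarith) hT).const_mul A
  have hbound : ∫⁻ t in Set.Ioi (0 : ℝ), P {x | t < max (|x| - T) 0} *
      ENNReal.ofReal (t ^ ((2 : ℝ) - 1)) ≤ ENNReal.ofReal (A / (p - 2) * T ^ (2 - p)) := by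
    calc _ ≤ ∫⁻ t in Set.Ioi (0 : ℝ), ENNReal.ofReal (A * (T + t) ^ (1 - p)) := by
          refine setLIntegral_mono' measurableSet_Ioi fun t ht => ?_
          have ht0 : 0 < t := ht
          have hset : {x : ℝ | t < max (|x| - T) 0} = {x | T + t < |x|} := by
            ext x
            simp only [Set.mem_ofPred_eq, lt_max_iff]
            constructor
            · rintro (h1 | h1) <;> linarith
            · intro h1; left; linarith
          have h2 := h (T + t) (by linarith)
          rw [hset, ← ofReal_measureReal (by finiteness), ← ENNReal.ofReal_mul measureReal_nonneg]
          refine ENNReal.ofReal_le_ofReal ?_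
          have h3 : t ^ ((2 : ℝ) - 1) ≤ T + t := by norm_num; linarith
          calc _ ≤ A * (T + t) ^ (-p) * (T + t) := by gcongr
            _ = A * (T + t) ^ (1 - p) := by
              rw [mul_assoc, ← Real.rpow_add_one (by positivity)]
              congr 2; ring
      _ = ∫⁻ u in Set.Ioi T, ENNReal.ofReal (A * u ^ (1 - p)) := by
          have h4 := (measurePreserving_add_left (volume : Measure ℝ) T).setLIntegral_comp_preimage
            (s := Set.Ioi T) measurableSet_Ioi
            (f := fun u => ENNReal.ofReal (A * u ^ (1 - p))) (by fun_prop)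
          rw [← h4]
          simp
      _ = ENNReal.ofReal (A / (p - 2) * T ^ (2 - p)) := by
          rw [← ofReal_integral_eq_lintegral_ofReal hint]
          · rw [integral_const_mul, integral_Ioi_rpow_of_lt (by linarith) hT]
            congr 1
            rw [show 1 - p + 1 = 2 - p by ring, show 2 - p = -(p - 2) by ring]
            field_simp
          · filter_upwards [ae_restrict_mem measurableSet_Ioi] with u hu
            have hu0 : 0 < u := hT.trans hu
            positivity
  rw [integral_eq_lintegral_of_nonneg_ae (ae_of_all _ fun x => sq_nonneg _) (by fun_prop)]
  refine ENNReal.toReal_le_of_le_ofReal (by positivity) ?_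
  simp only [Real.rpow_two] at hlc
  rw [hlc]
  calc _ ≤ ENNReal.ofReal 2 * ENNReal.ofReal (A / (p - 2) * T ^ (2 - p)) := by gcongr
    _ = _ := by
      rw [← ENNReal.ofReal_mul two_pos.le]
      congr 1; ring

/-- Under a power tail of order above `2`, truncation at a fixed level keeps most of the second
moment, uniformly in the law. -/
lemma exists_truncation_level (A p : ℝ) (hA : 0 ≤ A) (hp : 2 < p) :
    ∃ L : ℝ, 0 ≤ L ∧ ∀ P : Measure ℝ, IsProbabilityMeasure P →
      Integrable (fun x : ℝ => x ^ 2) P → ∫ x, x ^ 2 ∂P = 1 → HasPowerTail P A p 2 →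
      3 / 4 ≤ ∫ x, min (x ^ 2) L ∂P := by
  have hlim : Filter.Tendsto (fun T : ℝ => 4 * (2 * A / (p - 2) * T ^ (2 - p))) Filter.atTop
      (nhds (4 * (2 * A / (p - 2) * 0))) := by
    refine ((tendsto_rpow_neg_atTop (y := p - 2) (by linarith)).const_mul _).const_mul 4 |>.congr ?_
    intro T
    rw [neg_sub]
  have hev := hlim.eventually_le_const (u := 1 / 4) (by norm_num)
  obtain ⟨M, hM, hM2⟩ := (hev.and (Filter.eventually_ge_atTop (2 : ℝ))).exists
  refine ⟨(2 * M) ^ 2, by positivity, fun P _ hi h1 ht => ?_⟩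
  have hE := (ht.mono hM2).integral_sq_le hA hp (by linarith)
  have hM' : 4 * (2 * A / (p - 2) * M ^ (2 - p)) ≤ 1 / 4 := hM
  have hmin : Integrable (fun x : ℝ => min (x ^ 2) ((2 * M) ^ 2)) P :=
    hi.inf (integrable_const _)
  have hex : Integrable (fun x : ℝ => 4 * (max (|x| - M) 0) ^ 2) P :=
    (memLp_excess hi (by linarith)).integrable_sq.const_mul 4
  have hle : ∫ x, x ^ 2 ∂P ≤ ∫ x, (min (x ^ 2) ((2 * M) ^ 2) + 4 * (max (|x| - M) 0) ^ 2) ∂P := by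
    refine integral_mono hi (hmin.add hex) fun x => ?_
    dsimp only
    rcases le_total (|x|) (2 * M) with hx | hx
    · have : x ^ 2 ≤ (2 * M) ^ 2 := by
        rw [← sq_abs x]
        exact pow_le_pow_left₀ (abs_nonneg x) hx 2
      rw [min_eq_left this]
      nlinarith [sq_nonneg (max (|x| - M) 0)]
    · have h2 : (0 : ℝ) ≤ min (x ^ 2) ((2 * M) ^ 2) := le_min (sq_nonneg _) (sq_nonneg _)
      rw [max_eq_left (by linarith), ← sq_abs x]
      rw [← sq_abs x] at h2
      nlinarith
  rw [integral_add hmin hex, integral_const_mul, h1] at hle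
  linarith

/-! ### Sums of powers -/

lemma sum_range_rpow_neg_le {β : ℝ} (hβ0 : 0 ≤ β) (hβ : β < 1) (n : ℕ) :
    ∑ i ∈ Finset.range n, ((i : ℝ) + 1) ^ (-β) ≤ (n : ℝ) ^ (1 - β) / (1 - β) := by
  have h1 : 0 < 1 - β := by linarith
  rw [le_div_iff₀ h1]
  induction n with
  | zero => simp; positivity
  | succ n ih =>
    rw [Finset.sum_range_succ, add_mul]
    have hn : (0 : ℝ) < (n : ℝ) + 1 := by positivity
    have h2 := rpow_one_add_le_one_add_mul_self (s := -1 / ((n : ℝ) + 1))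
      (by rw [le_div_iff₀ hn]; linarith [Nat.cast_nonneg (α := ℝ) n]) h1.le (by linarith)
    have h3 : 1 + -1 / ((n : ℝ) + 1) = n / ((n : ℝ) + 1) := by field_simp; ring
    rw [h3, Real.div_rpow (Nat.cast_nonneg n) hn.le, div_le_iff₀ (by positivity)] at h2
    have h4 : ((n : ℝ) + 1) ^ (1 - β) = ((n : ℝ) + 1) ^ (-β) * ((n : ℝ) + 1) := by
      rw [← Real.rpow_add_one hn.ne']
      congr 1; ring
    push_cast
    rw [h4] at h2 ⊢
    have h5 : (1 + (1 - β) * (-1 / ((n : ℝ) + 1))) * (((n : ℝ) + 1) ^ (-β) * ((n : ℝ) + 1)) =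
        ((n : ℝ) + 1) ^ (-β) * ((n : ℝ) + 1) - (1 - β) * ((n : ℝ) + 1) ^ (-β) := by
      field_simp
      ring
    linarith

lemma headSq_eq_sum_range {s d : ℕ} (hsd : s ≤ d) (w : ℕ → ℝ) :
    headSq d s w = ∑ i ∈ Finset.range s, w (i + 1) ^ 2 := by
  rw [headSq, Fin.sum_univ_eq_sum_range (fun i => if i < s then w (i + 1) ^ 2 else 0) d,
    ← Finset.sum_filter]
  congr 1
  ext i
  simp only [Finset.mem_filter, Finset.mem_range]
  omega

/-- The squares of regularly varying weights are summed by their last term. -/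
lemma headSq_le {w : ℕ → ℝ} {K β : ℝ} {s d : ℕ} (hK : 0 ≤ K) (hβ0 : 0 ≤ β) (hβ : β < 1)
    (hsd : s ≤ d) (hs : 1 ≤ s)
    (hreg : ∀ j, 1 ≤ j → j ≤ s → w j ^ 2 ≤ K * w s ^ 2 * ((s : ℝ) / j) ^ β) :
    headSq d s w ≤ K / (1 - β) * (s * w s ^ 2) := by
  have hs0 : (0 : ℝ) < s := by exact_mod_cast hs
  rw [headSq_eq_sum_range hsd]
  calc ∑ i ∈ Finset.range s, w (i + 1) ^ 2
      ≤ ∑ i ∈ Finset.range s, K * w s ^ 2 * (s : ℝ) ^ β * ((i : ℝ) + 1) ^ (-β) := by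
        refine Finset.sum_le_sum fun i hi => ?_
        refine (hreg (i + 1) (by omega) (by simpa using hi)).trans (le_of_eq ?_)
        push_cast
        rw [Real.div_rpow hs0.le (by positivity), Real.rpow_neg (by positivity)]
        ring
    _ = K * w s ^ 2 * (s : ℝ) ^ β * ∑ i ∈ Finset.range s, ((i : ℝ) + 1) ^ (-β) := by
        rw [Finset.mul_sum]
    _ ≤ K * w s ^ 2 * (s : ℝ) ^ β * ((s : ℝ) ^ (1 - β) / (1 - β)) := by
        gcongr
        exact sum_range_rpow_neg_le hβ0 hβ s
    _ = K / (1 - β) * (s * w s ^ 2) := by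
        have h1 : (s : ℝ) ^ β * (s : ℝ) ^ (1 - β) = s := by
          rw [← Real.rpow_add hs0]; simp
        calc _ = K * w s ^ 2 * ((s : ℝ) ^ β * (s : ℝ) ^ (1 - β)) / (1 - β) := by ring
          _ = _ := by rw [h1]; ring

/-! ### The risk bound for regularly varying weights -/

lemma headSq_const_mul (d s : ℕ) (κ : ℝ) (w : ℕ → ℝ) :
    headSq d s (fun j => κ * w j) = κ ^ 2 * headSq d s w := by
  simp only [headSq, Finset.mul_sum, mul_ite, mul_zero, mul_pow]

lemma headSq_self (d : ℕ) (w : ℕ → ℝ) : headSq d d w = ∑ i : Fin d, w (i + 1) ^ 2 := by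
  simp [headSq]

/-- For `γ = 1 / N` there are `m = ⌊d / N⌋` blocks, each of them has at least `N` elements, and `m`
is of the order `d / N`. -/
lemma floor_inv_mul_bounds {N d : ℕ} (hN : 0 < N) (hm : 0 < ⌊(1 / (N : ℝ)) * d⌋₊) :
    N ≤ d / ⌊(1 / (N : ℝ)) * d⌋₊ ∧ (d : ℝ) ≤ 2 * N * ⌊(1 / (N : ℝ)) * d⌋₊ ∧
      ⌊(1 / (N : ℝ)) * d⌋₊ ≤ d := by
  have hNR : (0 : ℝ) < N := by exact_mod_cast hN
  set m := ⌊(1 / (N : ℝ)) * d⌋₊ with hmdef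
  have h1 : (m : ℝ) ≤ 1 / (N : ℝ) * d := Nat.floor_le (by positivity)
  have h2 : 1 / (N : ℝ) * d < m + 1 := Nat.lt_floor_add_one _
  have h3 : (N : ℝ) * m ≤ d := by
    rw [one_div, inv_mul_eq_div, le_div_iff₀ hNR] at h1
    linarith
  have h3' : N * m ≤ d := by exact_mod_cast h3
  refine ⟨(Nat.le_div_iff_mul_le hm).mpr h3', ?_, ?_⟩
  · have hm1 : (1 : ℝ) ≤ m := by exact_mod_cast hm
    rw [one_div, inv_mul_eq_div, div_lt_iff₀ hNR] at h2
    nlinarith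
  · exact (Nat.le_mul_of_pos_left m hN).trans h3'

/-- The risk bound for the weights `9 κ w_j`, where `w` varies regularly enough for the sums of
`w_j ^ 2` over `j ≤ s` to be of the order of `s w_s ^ 2`. -/
theorem slope_risk_le_of_regular {P : Measure ℝ} [IsProbabilityMeasure P]
    (hi : Integrable (fun x : ℝ => x ^ 2) P) (h1 : ∫ x, x ^ 2 ∂P = 1)
    {L σ κ K K₁ β : ℝ} {N m s d : ℕ} {w : ℕ → ℝ} {v : Fin d → ℝ}
    (hL : 0 ≤ L) (h34 : 3 / 4 ≤ ∫ x, min (x ^ 2) L ∂P) (hN : 0 < N) (hNL : 128 * L ≤ N)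
    (hκ : 0 < κ) (hK : 0 ≤ K) (hβ0 : 0 ≤ β) (hβ : β < 1)
    (hw : Antitone fun i : Fin d => w (i + 1)) (hwd : w d = 1)
    (hreg : ∀ s j : ℕ, 1 ≤ j → j ≤ s → s ≤ d → w j ^ 2 ≤ K * w s ^ 2 * ((s : ℝ) / j) ^ β)
    (hv : ∀ i : Fin d, ∫ x : ℝ, (max (|x| - κ * w (i + 1)) 0) ^ 2 ∂P ≤ v i)
    (hvT : ∀ i : Fin d, d * v i ≤ (i + 1) * (κ * w (i + 1)) ^ 2)
    (hs1 : 1 ≤ s) (h4s : 4 * s < m) (hblock : N ≤ d / m) (hdm : (d : ℝ) ≤ 2 * N * m) (hmd : m ≤ d)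
    (hsum : ∑ i : Fin d, d / ((i : ℝ) + 1) ^ 2 * v i ≤ K₁ * (s * w s ^ 2))
    {B : Fin m → Finset (Fin d)} (hB : IsBlockDivision B)
    {V : EuclideanSpace ℝ (Fin d) → ℝ} (hV : IsMedianOfMeans B V)
    {θhat : EuclideanSpace ℝ (Fin d) → EuclideanSpace ℝ (Fin d)}
    (hθhat : IsSlopeEstimator (fun j => 9 * κ * w j) V θhat) {θ : EuclideanSpace ℝ (Fin d)}
    (hθ : sparsity θ ≤ s) (hσ : 0 < σ) :
    Integrable (fun y => ‖θhat y - θ‖ ^ 2) (obsLaw θ P σ) ∧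
    ∫ y, ‖θhat y - θ‖ ^ 2 ∂(obsLaw θ P σ) ≤
      (16 * K₁ + (2304 * N + 2592) * κ ^ 2 * (K / (1 - β))) * σ ^ 2 * (s * w s ^ 2) := by
  have hm0 : (0 : ℝ) < m := by exact_mod_cast (by omega : 0 < m)
  have hw1 : ∀ j : ℕ, 1 ≤ j → j ≤ d → 1 ≤ w j := by
    intro j hj hjd
    have := @hw ⟨j - 1, by omega⟩ ⟨d - 1, by omega⟩ (Fin.mk_le_mk.mpr (by omega))
    simp only [Nat.sub_add_cancel hj, Nat.sub_add_cancel (hj.trans hjd), hwd] at this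
    exact this
  have hTpos : ∀ i : Fin d, 0 < κ * w (i + 1) := fun i =>
    mul_pos hκ (zero_lt_one.trans_le (hw1 _ (by omega) (by omega)))
  have hTw : IsWeight d fun j => κ * w j :=
    ⟨fun i j hij => mul_le_mul_of_nonneg_left (hw hij) hκ.le, fun i => (hTpos i).le⟩
  have hcardN : ∀ i, N ≤ (B i).card := fun i => hblock.trans (hB.card_le i)
  have hest : IsSlopeEstimator (fun j => 9 * (κ * w j)) V θhat := by
    simpa only [mul_assoc] using hθhat
  obtain ⟨h2, h3⟩ := slope_risk_le hi h1 hL h34 hTw hTpos hv hvT hB h4s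
    (fun i => hNL.trans (by exact_mod_cast hcardN i)) (fun i => hN.trans_le (hcardN i)) hV hest hθ
    hσ
  refine ⟨h2, h3.trans ?_⟩
  have hβ' : 0 < 1 - β := by linarith
  have hhead := headSq_le (d := d) hK hβ0 hβ (by omega : s ≤ d) hs1
    fun j hj hjs => hreg s j hj hjs (by omega)
  have htot := headSq_le (d := d) hK hβ0 hβ le_rfl (by omega : 1 ≤ d)
    fun j hj hjd => hreg d j hj hjd le_rfl
  rw [hwd, one_pow, mul_one] at htot
  have hsw : 1 ≤ s * w s ^ 2 := by
    have e1 : (1 : ℝ) ≤ s := by exact_mod_cast hs1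
    have e2 := one_le_pow₀ (n := 2) (hw1 s hs1 (by omega))
    nlinarith
  rw [headSq_const_mul]
  have e3 : ∑ i : Fin d, (κ * w (i + 1)) ^ 2 = κ ^ 2 * headSq d d w := by
    rw [headSq_self, Finset.mul_sum]
    exact Finset.sum_congr rfl fun i _ => by ring
  rw [e3]
  have hKβ : 0 ≤ K / (1 - β) := by positivity
  have e4 : 1152 / (m : ℝ) * (κ ^ 2 * headSq d d w) ≤
      2304 * N * κ ^ 2 * (K / (1 - β)) * (s * w s ^ 2) := by
    calc 1152 / (m : ℝ) * (κ ^ 2 * headSq d d w)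
        ≤ 1152 / (m : ℝ) * (κ ^ 2 * (K / (1 - β) * (2 * N * m))) := by
          gcongr
          exact htot.trans (by gcongr)
      _ = 2304 * N * κ ^ 2 * (K / (1 - β)) * 1 := by field_simp; ring
      _ ≤ _ := by gcongr
  have e5 : 2592 * (κ ^ 2 * headSq d s w) ≤
      2592 * (κ ^ 2 * (K / (1 - β) * (s * w s ^ 2))) := by gcongr
  calc _ ≤ σ ^ 2 * (16 * (K₁ * (s * w s ^ 2))
        + 2304 * N * κ ^ 2 * (K / (1 - β)) * (s * w s ^ 2)
        + 2592 * (κ ^ 2 * (K / (1 - β) * (s * w s ^ 2)))) := by gcongr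
    _ = _ := by ring

/-! ### The two noise classes -/

lemma integrable_sq_of_integral_eq_one {P : Measure ℝ} (h : ∫ x, x ^ 2 ∂P = 1) :
    Integrable (fun x : ℝ => x ^ 2) P := by
  by_contra hni
  rw [integral_undef hni] at h
  exact zero_ne_one h

section pol
variable {a τ : ℝ}

lemma hasPowerTail_of_mem_polTailClass (hτ : 0 < τ) {P : Measure ℝ}
    (hP : P ∈ polTailClass a τ) : HasPowerTail P (τ ^ a) a 2 := by
  intro t ht
  refine (hP.2.2.2 t ht).trans (le_of_eq ?_)
  rw [Real.div_rpow hτ.le (by linarith), Real.rpow_neg (by linarith), div_eq_mul_inv]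

lemma polWeights_one_sq {d j : ℕ} : polWeights 1 a d j ^ 2 = ((d : ℝ) / j) ^ (2 / a) := by
  rw [polWeights, one_mul, ← Real.rpow_natCast, ← Real.rpow_mul (by positivity)]
  congr 1
  push_cast
  ring

lemma mul_polWeights_one_sq {s d : ℕ} : s * polWeights 1 a d s ^ 2 = phiPol a s d ^ 2 := by
  rw [phiPol, polWeights, one_mul, mul_pow, Real.sq_sqrt (Nat.cast_nonneg s)]

lemma polWeights_one_anti (ha : 0 < a) (d : ℕ) :
    Antitone fun i : Fin d => polWeights 1 a d (i + 1) := by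
  intro i j hij
  have : (i : ℝ) ≤ j := by exact_mod_cast hij
  simp only [polWeights, one_mul]
  push_cast
  gcongr

/-- Here the regularity condition of `slope_risk_le_of_regular` is an identity. -/
lemma polWeights_regular (d s j : ℕ) (hj : 1 ≤ j) (hjs : j ≤ s) :
    polWeights 1 a d j ^ 2 ≤ 1 * polWeights 1 a d s ^ 2 * ((s : ℝ) / j) ^ (2 / a) := by
  have hj0 : (0 : ℝ) < j := by exact_mod_cast hj
  have hs0 : (0 : ℝ) < s := by exact_mod_cast hj.trans hjs
  rw [polWeights_one_sq, polWeights_one_sq, one_mul,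
    ← Real.mul_rpow (by positivity) (by positivity)]
  refine le_of_eq ?_
  congr 1
  field_simp

/-- At a level `κ (d / j)^{1/a}` with large `κ` the mean squared excess is at most
`j / d` times the squared level. -/
lemma polTail_excess_le (ha : 2 < a) (hτ : 0 < τ) {P : Measure ℝ} (hP : P ∈ polTailClass a τ)
    {κ : ℝ} (hκ2 : 2 ≤ κ) (hκ : 2 * τ ^ a / (a - 2) ≤ κ) {d j : ℕ} (hj : 1 ≤ j) (hjd : j ≤ d) :
    ∫ x : ℝ, (max (|x| - κ * polWeights 1 a d j) 0) ^ 2 ∂P ≤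
      j / d * (κ * polWeights 1 a d j) ^ 2 := by
  have := hP.1
  have ha2 : 0 < a - 2 := by linarith
  have hj0 : (0 : ℝ) < j := by exact_mod_cast hj
  have hd0 : (0 : ℝ) < d := by exact_mod_cast hj.trans hjd
  set w := polWeights 1 a d j with hw
  have hwa : w ^ a = d / j := by
    rw [hw, polWeights, one_mul, ← Real.rpow_mul (by positivity)]
    rw [one_div_mul_cancel (by linarith), Real.rpow_one]
  have hw1 : 1 ≤ w := by
    rw [hw, polWeights, one_mul]
    refine Real.one_le_rpow ?_ (by positivity)
    rw [le_div_iff₀ hj0, one_mul]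
    exact_mod_cast hjd
  have hκ0 : 0 < κ := by linarith
  have hT : 2 ≤ κ * w := by nlinarith
  have h1 := ((hasPowerTail_of_mem_polTailClass hτ hP).mono hT).integral_sq_le
    (by positivity) ha (by linarith)
  refine h1.trans ?_
  have hκa : 2 * τ ^ a / (a - 2) ≤ κ ^ a := by
    refine hκ.trans ?_
    calc κ = κ ^ (1 : ℝ) := (Real.rpow_one κ).symm
      _ ≤ κ ^ a := Real.rpow_le_rpow_of_exponent_le (by linarith) (by linarith)
  have h2 : (κ * w) ^ (2 - a) = (κ * w) ^ 2 / (κ ^ a * (d / j)) := by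
    rw [Real.rpow_sub (by positivity), Real.rpow_two, Real.mul_rpow hκ0.le (by linarith), hwa]
  rw [h2]
  calc _ ≤ κ ^ a * ((κ * w) ^ 2 / (κ ^ a * (d / j))) := by gcongr
    _ = _ := by
      have : κ ^ a ≠ 0 := (Real.rpow_pos_of_pos hκ0 a).ne'
      field_simp

lemma exists_sum_rpow_le {β : ℝ} (hβ : 0 < β) :
    ∃ K : ℝ, 0 ≤ K ∧ ∀ d : ℕ, ∑ i ∈ Finset.range d, ((i : ℝ) + 1) ^ (-1 - β) ≤ K := by
  have hsum : Summable fun n : ℕ => ((n : ℝ) + 1) ^ (-1 - β) := by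
    have h1 : Summable fun n : ℕ => (n : ℝ) ^ (-1 - β) :=
      Real.summable_nat_rpow.mpr (by linarith)
    have h2 := (summable_nat_add_iff 1).mpr h1
    simpa using h2
  exact ⟨_, tsum_nonneg fun n => by positivity,
    fun d => hsum.sum_le_tsum _ fun n _ => by positivity⟩

lemma sum_polTail_excess_le (ha : 2 < a) {K κ : ℝ}
    (hK : ∀ d : ℕ, ∑ i ∈ Finset.range d, ((i : ℝ) + 1) ^ (-1 - 2 / a) ≤ K)
    {s d : ℕ} (hs : 1 ≤ s) :
    ∑ i : Fin d, d / ((i : ℝ) + 1) ^ 2 *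
      (((i + 1 : ℕ) : ℝ) / d * (κ * polWeights 1 a d (i + 1)) ^ 2) ≤
      κ ^ 2 * K * (s * polWeights 1 a d s ^ 2) := by
  have hs1 : (1 : ℝ) ≤ s := by exact_mod_cast hs
  have hs0 : (0 : ℝ) < s := by linarith
  have ha0 : 0 < a := by linarith
  have hterm : ∀ i : Fin d, d / ((i : ℝ) + 1) ^ 2 *
      (((i + 1 : ℕ) : ℝ) / d * (κ * polWeights 1 a d (i + 1)) ^ 2) =
      κ ^ 2 * (d : ℝ) ^ (2 / a) * ((i : ℝ) + 1) ^ (-1 - 2 / a) := by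
    intro i
    have hd0 : (d : ℝ) ≠ 0 := by exact_mod_cast i.pos.ne'
    have hi0 : (0 : ℝ) < (i : ℝ) + 1 := by positivity
    rw [mul_pow, polWeights_one_sq]
    push_cast
    rw [Real.div_rpow (Nat.cast_nonneg d) hi0.le, Real.rpow_sub hi0, Real.rpow_neg_one]
    field_simp
  rw [Finset.sum_congr rfl fun i _ => hterm i, ← Finset.mul_sum,
    Fin.sum_univ_eq_sum_range (fun i => ((i : ℝ) + 1) ^ (-1 - 2 / a)) d, polWeights_one_sq]
  have hK0 : 0 ≤ K := by simpa using hK 0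
  have h1 : (d : ℝ) ^ (2 / a) ≤ s * ((d : ℝ) / s) ^ (2 / a) := by
    rw [Real.div_rpow (Nat.cast_nonneg d) hs0.le, mul_div_assoc', le_div_iff₀ (by positivity),
      mul_comm (s : ℝ)]
    gcongr
    calc (s : ℝ) ^ (2 / a) ≤ (s : ℝ) ^ (1 : ℝ) :=
          Real.rpow_le_rpow_of_exponent_le hs1 (by rw [div_le_one ha0]; exact ha.le)
      _ = s := Real.rpow_one _
  calc _ ≤ κ ^ 2 * (s * ((d : ℝ) / s) ^ (2 / a)) * K := by
        gcongr
        exact hK d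
    _ = _ := by ring

end pol

section exp
variable {a τ : ℝ}

/-- Half of the exponent already gives a cubic tail. The other half is kept for the decay in the
level, see `hasPowerTail_of_mem_expTailClass`. -/
lemma exists_exp_tail_le (ha : 0 < a) (hτ : 0 < τ) :
    ∃ A : ℝ, 0 ≤ A ∧ ∀ t : ℝ, 0 < t → Real.exp (-((t / τ) ^ a / 2)) ≤ A * t ^ (-3 : ℝ) := by
  obtain ⟨n, hn⟩ := exists_nat_ge (3 / a)
  refine ⟨n.factorial * 2 ^ (3 / a) * τ ^ (3 : ℝ), by positivity, fun t ht => ?_⟩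
  set y := (t / τ) ^ a / 2 with hy
  have hy0 : 0 ≤ y := by positivity
  have hfac : (1 : ℝ) ≤ n.factorial := by exact_mod_cast n.factorial_pos
  have h1 : y ^ (3 / a) ≤ n.factorial * Real.exp y := by
    rcases le_total y 1 with h | h
    · calc y ^ (3 / a) ≤ 1 := Real.rpow_le_one hy0 h (by positivity)
        _ ≤ n.factorial * Real.exp y := by nlinarith [Real.one_le_exp hy0]
    · calc y ^ (3 / a) ≤ y ^ (n : ℝ) := Real.rpow_le_rpow_of_exponent_le h hn
        _ = y ^ n := Real.rpow_natCast y n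
        _ ≤ n.factorial * Real.exp y := by
          have := Real.pow_div_factorial_le_exp y hy0 n
          rwa [div_le_iff₀ (by positivity), mul_comm] at this
  have h2 : y ^ (3 / a) = (t ^ (3 : ℝ) / τ ^ (3 : ℝ)) / 2 ^ (3 / a) := by
    rw [hy, Real.div_rpow (by positivity) two_pos.le, ← Real.rpow_mul (by positivity),
      mul_div_cancel₀ _ ha.ne', Real.div_rpow ht.le hτ.le]
  rw [Real.exp_neg, Real.rpow_neg ht.le, ← div_eq_mul_inv, le_div_iff₀ (by positivity),
    inv_mul_eq_div, div_le_iff₀ (Real.exp_pos y)]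
  rw [h2, div_div, div_le_iff₀ (by positivity)] at h1
  calc t ^ (3 : ℝ) ≤ _ := h1
    _ = _ := by ring

/-- Beyond a level `T`, an exponential tail is a power tail with a constant that decays in `T`. -/
lemma hasPowerTail_of_mem_expTailClass (ha : 0 < a) (hτ : 0 < τ) {A : ℝ}
    (hA : ∀ t : ℝ, 0 < t → Real.exp (-((t / τ) ^ a / 2)) ≤ A * t ^ (-3 : ℝ))
    {P : Measure ℝ} (hP : P ∈ expTailClass a τ) {T : ℝ} (hT : 2 ≤ T) :
    HasPowerTail P (2 * A * Real.exp (-((T / τ) ^ a / 2))) 3 T := by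
  intro t ht
  have ht0 : 0 < t := by linarith
  refine (hP.2.2.2 t (hT.trans ht)).trans ?_
  have h1 : Real.exp (-(t / τ) ^ a) =
      Real.exp (-((t / τ) ^ a / 2)) * Real.exp (-((t / τ) ^ a / 2)) := by
    rw [← Real.exp_add]
    congr 1; ring
  have h2 : Real.exp (-((t / τ) ^ a / 2)) ≤ Real.exp (-((T / τ) ^ a / 2)) := by
    have : (T / τ) ^ a ≤ (t / τ) ^ a := by gcongr
    exact Real.exp_le_exp.mpr (by linarith)
  rw [h1]
  calc _ ≤ 2 * (Real.exp (-((T / τ) ^ a / 2)) * (A * t ^ (-3 : ℝ))) := by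
        gcongr
        exact hA t ht0
    _ = _ := by ring

lemma one_le_log_ratio {d j : ℕ} (hj : 1 ≤ j) (hjd : j ≤ d) :
    1 ≤ Real.log (Real.exp 1 * d / j) := by
  have hj0 : (0 : ℝ) < j := by exact_mod_cast hj
  have hjd' : (j : ℝ) ≤ d := by exact_mod_cast hjd
  rw [Real.le_log_iff_exp_le (by have := hj0.trans_le hjd'; positivity), mul_div_assoc]
  refine le_mul_of_one_le_right (Real.exp_pos 1).le ?_
  rwa [le_div_iff₀ hj0, one_mul]

lemma expWeights_one_sq {d j : ℕ} (hj : 1 ≤ j) (hjd : j ≤ d) :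
    expWeights 1 a d j ^ 2 = Real.log (Real.exp 1 * d / j) ^ (2 / a) := by
  have := one_le_log_ratio hj hjd
  rw [expWeights, one_mul, ← Real.rpow_natCast, ← Real.rpow_mul (by linarith)]
  congr 1
  push_cast
  ring

lemma mul_expWeights_one_sq {s d : ℕ} : s * expWeights 1 a d s ^ 2 = phiExp a s d ^ 2 := by
  rw [phiExp, expWeights, one_mul, mul_pow, Real.sq_sqrt (Nat.cast_nonneg s)]

lemma expWeights_one_anti (ha : 0 < a) (d : ℕ) :
    Antitone fun i : Fin d => expWeights 1 a d (i + 1) := by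
  intro i j hij
  have hij' : (i : ℝ) ≤ j := by exact_mod_cast hij
  have hd0 : (0 : ℝ) < d := by exact_mod_cast i.pos
  have h1 := one_le_log_ratio (d := d) (j := j + 1) (by omega) (by omega)
  simp only [expWeights, one_mul]
  push_cast at h1 ⊢
  gcongr

/-- Powers of the logarithm grow more slowly than the square root. -/
lemma exists_log_rpow_le {q : ℝ} (hq : 0 < q) :
    ∃ K : ℝ, 0 ≤ K ∧ ∀ x : ℝ, 1 ≤ x → (1 + Real.log x) ^ q ≤ K * x ^ (1 / 2 : ℝ) := by
  refine ⟨(2 * q) ^ q * Real.exp 1 ^ (1 / 2 : ℝ), by positivity, fun x hx => ?_⟩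
  have hx0 : 0 < x := by linarith
  have h1 : 1 + Real.log x = Real.log (Real.exp 1 * x) := by
    rw [Real.log_mul (Real.exp_pos 1).ne' hx0.ne', Real.log_exp]
  have hl : 0 ≤ 1 + Real.log x := by linarith [Real.log_nonneg hx]
  have h2 := Real.log_le_rpow_div (x := Real.exp 1 * x) (by positivity)
    (ε := 1 / (2 * q)) (by positivity)
  rw [← h1, div_div_eq_mul_div, div_one] at h2
  calc (1 + Real.log x) ^ q ≤ ((Real.exp 1 * x) ^ (1 / (2 * q)) * (2 * q)) ^ q := by gcongr
    _ = _ := by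
      rw [Real.mul_rpow (by positivity) (by positivity), ← Real.rpow_mul (by positivity),
        show 1 / (2 * q) * q = 1 / 2 by field_simp, Real.mul_rpow (Real.exp_pos 1).le hx0.le]
      ring

/-- `log (e d / j) ≤ log (e d / s) (1 + log (s / j))`, and powers of the last factor grow slowly. -/
lemma expWeights_regular (ha : 0 < a) {K : ℝ}
    (hK : ∀ x : ℝ, 1 ≤ x → (1 + Real.log x) ^ (2 / a) ≤ K * x ^ (1 / 2 : ℝ))
    (d s j : ℕ) (hj : 1 ≤ j) (hjs : j ≤ s) (hsd : s ≤ d) :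
    expWeights 1 a d j ^ 2 ≤ K * expWeights 1 a d s ^ 2 * ((s : ℝ) / j) ^ (1 / 2 : ℝ) := by
  have hj0 : (0 : ℝ) < j := by exact_mod_cast hj
  have hjs' : (j : ℝ) ≤ s := by exact_mod_cast hjs
  have hs0 : (0 : ℝ) < s := by linarith
  have hd0 : (0 : ℝ) < d := hs0.trans_le (by exact_mod_cast hsd)
  have h1 := one_le_log_ratio (hj.trans hjs) hsd
  have hx : 1 ≤ (s : ℝ) / j := by rwa [le_div_iff₀ hj0, one_mul]
  have h2 := Real.log_nonneg hx
  have h3 : Real.log (Real.exp 1 * d / j) =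
      Real.log (Real.exp 1 * d / s) + Real.log ((s : ℝ) / j) := by
    rw [← Real.log_mul (by positivity) (by positivity)]
    congr 1
    field_simp
  rw [expWeights_one_sq hj (hjs.trans hsd), expWeights_one_sq (hj.trans hjs) hsd, h3]
  calc _ ≤ (Real.log (Real.exp 1 * d / s) * (1 + Real.log ((s : ℝ) / j))) ^ (2 / a) := by
        gcongr
        nlinarith
    _ = Real.log (Real.exp 1 * d / s) ^ (2 / a) * (1 + Real.log ((s : ℝ) / j)) ^ (2 / a) :=
        Real.mul_rpow (by linarith) (by linarith)
    _ ≤ Real.log (Real.exp 1 * d / s) ^ (2 / a) * (K * ((s : ℝ) / j) ^ (1 / 2 : ℝ)) := by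
        gcongr
        exact hK _ hx
    _ = _ := by ring

/-- At a level `κ log^{1/a}(e d / j)` with large `κ` the mean squared excess is at most
`κ ^ 2 (j / d) ^ 2`. -/
lemma expTail_excess_le (ha : 0 < a) (hτ : 0 < τ) {A : ℝ} (hA0 : 0 ≤ A)
    (hA : ∀ t : ℝ, 0 < t → Real.exp (-((t / τ) ^ a / 2)) ≤ A * t ^ (-3 : ℝ))
    {P : Measure ℝ} (hP : P ∈ expTailClass a τ) {κ : ℝ} (hκ2 : 2 ≤ κ) (hκA : 4 * A ≤ κ)
    (hκτ : τ * 4 ^ (1 / a) ≤ κ) {d j : ℕ} (hj : 1 ≤ j) (hjd : j ≤ d) :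
    ∫ x : ℝ, (max (|x| - κ * expWeights 1 a d j) 0) ^ 2 ∂P ≤ κ ^ 2 * ((j : ℝ) / d) ^ 2 := by
  have := hP.1
  have hj0 : (0 : ℝ) < j := by exact_mod_cast hj
  have hd0 : (0 : ℝ) < d := by exact_mod_cast hj.trans hjd
  have hκ0 : 0 < κ := by linarith
  set l := Real.log (Real.exp 1 * d / j) with hl
  have hl1 : 1 ≤ l := one_le_log_ratio hj hjd
  have hl0 : 0 ≤ l := by linarith
  have hwl : expWeights 1 a d j = l ^ (1 / a) := by rw [expWeights, one_mul]
  have hw1 : 1 ≤ expWeights 1 a d j := hwl ▸ Real.one_le_rpow hl1 (by positivity)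
  set T := κ * expWeights 1 a d j with hT
  have hT2 : 2 ≤ T := by nlinarith
  have h1 := (hasPowerTail_of_mem_expTailClass ha hτ hA hP hT2).integral_sq_le
    (by positivity) (by norm_num) (by linarith)
  refine h1.trans ?_
  have h4 : 4 * l ≤ (T / τ) ^ a := by
    have e1 : (4 * l) ^ (1 / a) ≤ T / τ := by
      rw [le_div_iff₀ hτ, Real.mul_rpow (by norm_num) hl0, hT, hwl]
      have := mul_le_mul_of_nonneg_right hκτ (Real.rpow_nonneg hl0 (1 / a))
      linarith
    calc 4 * l = ((4 * l) ^ (1 / a)) ^ a := by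
          rw [← Real.rpow_mul (by positivity), one_div_mul_cancel ha.ne', Real.rpow_one]
      _ ≤ (T / τ) ^ a := by gcongr
  have h5 : Real.exp (-((T / τ) ^ a / 2)) ≤ ((j : ℝ) / d) ^ 2 := by
    calc Real.exp (-((T / τ) ^ a / 2)) ≤ Real.exp (-l + -l) := Real.exp_le_exp.mpr (by linarith)
      _ = ((j : ℝ) / (Real.exp 1 * d)) ^ 2 := by
        rw [Real.exp_add, Real.exp_neg, hl, Real.exp_log (by positivity), inv_div, pow_two]
      _ ≤ ((j : ℝ) / d) ^ 2 := by
        gcongr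
        exact le_mul_of_one_le_left hd0.le (Real.one_le_exp zero_le_one)
  have h6 : T ^ ((2 : ℝ) - 3) ≤ 1 :=
    Real.rpow_le_one_of_one_le_of_nonpos (by linarith) (by norm_num)
  calc 2 * (2 * A * Real.exp (-((T / τ) ^ a / 2))) / (3 - 2) * T ^ ((2 : ℝ) - 3)
      ≤ 2 * (2 * A * ((j : ℝ) / d) ^ 2) / (3 - 2) * 1 := by gcongr
    _ = 4 * A * ((j : ℝ) / d) ^ 2 := by ring
    _ ≤ κ ^ 2 * ((j : ℝ) / d) ^ 2 := by
      gcongr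
      nlinarith

end exp

/-! ### Adaptive rates over the two classes -/

/-- The least size `N` of a block, large compared to the truncation level `L`. -/
lemma exists_block_number (L : ℝ) : ∃ N : ℕ, 2 ≤ N ∧ 128 * L ≤ N := by
  obtain ⟨n, hn⟩ := exists_nat_ge (128 * L)
  exact ⟨max 2 n, le_max_left _ _, hn.trans (by exact_mod_cast le_max_right _ _)⟩

lemma sum_expTail_excess_eq {κ : ℝ} {d : ℕ} (hd : 1 ≤ d) :
    ∑ i : Fin d, d / ((i : ℝ) + 1) ^ 2 * (κ ^ 2 * (((i + 1 : ℕ) : ℝ) / d) ^ 2) = κ ^ 2 := by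
  have hd0 : (d : ℝ) ≠ 0 := by exact_mod_cast (by omega : d ≠ 0)
  have : ∀ i : Fin d, d / ((i : ℝ) + 1) ^ 2 * (κ ^ 2 * (((i + 1 : ℕ) : ℝ) / d) ^ 2) =
      κ ^ 2 / d := by
    intro i
    have hi0 : (i : ℝ) + 1 ≠ 0 := by positivity
    push_cast
    field_simp
  rw [Finset.sum_congr rfl fun i _ => this i]
  simp
  field_simp

theorem exists_risk_bound_expTailClass {a τ : ℝ} (ha : 0 < a) (hτ : 0 < τ) :
    ∃ c C γ : ℝ, 0 < c ∧ 0 < C ∧ 0 < γ ∧ γ ≤ 1 / 2 ∧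
      ∀ s d : ℕ, 1 ≤ s → (s : ℝ) < (⌊γ * (d : ℝ)⌋₊ : ℝ) / 4 →
      ∀ B : Fin ⌊γ * (d : ℝ)⌋₊ → Finset (Fin d), IsBlockDivision B →
      ∀ V : EuclideanSpace ℝ (Fin d) → ℝ, IsMedianOfMeans B V →
      ∀ θhat : EuclideanSpace ℝ (Fin d) → EuclideanSpace ℝ (Fin d),
        IsSlopeEstimator (expWeights c a d) V θhat →
      ∀ P ∈ expTailClass a τ, ∀ σ : ℝ, 0 < σ →
      ∀ θ : EuclideanSpace ℝ (Fin d), sparsity θ ≤ s →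
        Integrable (fun y => ‖θhat y - θ‖ ^ 2) (obsLaw θ P σ) ∧
        ∫ y, ‖θhat y - θ‖ ^ 2 ∂(obsLaw θ P σ) ≤ C * σ ^ 2 * phiExp a s d ^ 2 := by
  obtain ⟨A, hA0, hA⟩ := exists_exp_tail_le ha hτ
  obtain ⟨L, hL, htrunc⟩ := exists_truncation_level (2 * A) 3 (by positivity) (by norm_num)
  obtain ⟨N, hN2, hNL⟩ := exists_block_number L
  obtain ⟨K, hK0, hK⟩ := exists_log_rpow_le (q := 2 / a) (by positivity)
  have hN0 : (2 : ℝ) ≤ N := by exact_mod_cast hN2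
  -- The three lower bounds on `κ` are those of `expTail_excess_le`.
  set κ : ℝ := max 2 (max (4 * A) (τ * 4 ^ (1 / a)))
  have hκ2 : 2 ≤ κ := le_max_left _ _
  have hκA : 4 * A ≤ κ := (le_max_left _ _).trans (le_max_right _ _)
  have hκτ : τ * 4 ^ (1 / a) ≤ κ := (le_max_right _ _).trans (le_max_right _ _)
  have hκ0 : 0 < κ := by linarith
  refine ⟨9 * κ, 16 * κ ^ 2 + (2304 * N + 2592) * κ ^ 2 * (K / (1 - 1 / 2)), 1 / N,
    by positivity, by norm_num; positivity, by positivity,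
    one_div_le_one_div_of_le two_pos hN0, ?_⟩
  intro s d hs1 hs B hB V hV θhat hθhat P hP σ hσ θ hθ
  have hPp := hP.1
  have hi := integrable_sq_of_integral_eq_one hP.2.2.1
  have h4s : 4 * s < ⌊1 / (N : ℝ) * d⌋₊ := by
    have : (4 * s : ℝ) < ⌊1 / (N : ℝ) * d⌋₊ := by linarith
    exact_mod_cast this
  obtain ⟨hblock, hdm, hmd⟩ := floor_inv_mul_bounds (N := N) (d := d) (by omega) (by omega)
  have hsd : s ≤ d := by omega
  have hd0 : (0 : ℝ) < d := by exact_mod_cast (by omega : 0 < d)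
  have htail : HasPowerTail P (2 * A) 3 2 :=
    (hasPowerTail_of_mem_expTailClass ha hτ hA hP le_rfl).mono_const
      (mul_le_of_le_one_right (by positivity)
        (Real.exp_le_one_iff.mpr (neg_nonpos.mpr (by positivity)))) zero_le_two
  have hest : IsSlopeEstimator (fun j => 9 * κ * expWeights 1 a d j) V θhat := by
    have : (fun j => 9 * κ * expWeights 1 a d j) = expWeights (9 * κ) a d := by
      funext j
      simp only [expWeights, one_mul]
    rwa [this]
  have hw1 : ∀ j, 1 ≤ j → j ≤ d → 1 ≤ expWeights 1 a d j ^ 2 := by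
    intro j hj hjd
    rw [expWeights_one_sq hj hjd]
    exact Real.one_le_rpow (one_le_log_ratio hj hjd) (by positivity)
  have hwd : expWeights 1 a d d = 1 := by
    rw [expWeights, mul_div_cancel_right₀ _ hd0.ne', Real.log_exp, Real.one_rpow, one_mul]
  have hmain := slope_risk_le_of_regular hi hP.2.2.1 (K₁ := κ ^ 2)
    (v := fun i => κ ^ 2 * (((i + 1 : ℕ) : ℝ) / d) ^ 2) hL
    (htrunc P hPp hi hP.2.2.1 htail) (by omega) hNL hκ0 hK0 (by norm_num) (by norm_num)
    (expWeights_one_anti ha d) hwd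
    (fun s j hj hjs hsd => expWeights_regular ha hK d s j hj hjs hsd)
    (fun i => expTail_excess_le ha hτ hA0 hA hP hκ2 hκA hκτ (by omega) (by omega))
    (fun i => ?_) hs1 h4s hblock hdm hmd ?_ hB hV hest hθ hσ
  · rwa [mul_expWeights_one_sq] at hmain
  · have hid : ((i + 1 : ℕ) : ℝ) ≤ d := by exact_mod_cast i.isLt
    have hw := hw1 (i + 1) (by omega) (by omega)
    push_cast at hid ⊢
    calc d * (κ ^ 2 * (((i : ℝ) + 1) / d) ^ 2)
        = ((i : ℝ) + 1) * (κ ^ 2 * (((i : ℝ) + 1) / d)) := by field_simp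
      _ ≤ ((i : ℝ) + 1) * (κ ^ 2 * expWeights 1 a d (i + 1) ^ 2) := by
          gcongr
          exact ((div_le_one hd0).mpr hid).trans hw
      _ = _ := by ring
  · rw [sum_expTail_excess_eq (by omega)]
    have e1 : (1 : ℝ) ≤ s := by exact_mod_cast hs1
    have e2 := hw1 s hs1 hsd
    exact le_mul_of_one_le_right (by positivity) (by nlinarith)

theorem exists_risk_bound_polTailClass {a τ : ℝ} (ha : 2 < a) (hτ : 0 < τ) :
    ∃ c C γ : ℝ, 0 < c ∧ 0 < C ∧ 0 < γ ∧ γ ≤ 1 / 2 ∧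
      ∀ s d : ℕ, 1 ≤ s → (s : ℝ) < (⌊γ * (d : ℝ)⌋₊ : ℝ) / 4 →
      ∀ B : Fin ⌊γ * (d : ℝ)⌋₊ → Finset (Fin d), IsBlockDivision B →
      ∀ V : EuclideanSpace ℝ (Fin d) → ℝ, IsMedianOfMeans B V →
      ∀ θhat : EuclideanSpace ℝ (Fin d) → EuclideanSpace ℝ (Fin d),
        IsSlopeEstimator (polWeights c a d) V θhat →
      ∀ P ∈ polTailClass a τ, ∀ σ : ℝ, 0 < σ →
      ∀ θ : EuclideanSpace ℝ (Fin d), sparsity θ ≤ s →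
        Integrable (fun y => ‖θhat y - θ‖ ^ 2) (obsLaw θ P σ) ∧
        ∫ y, ‖θhat y - θ‖ ^ 2 ∂(obsLaw θ P σ) ≤ C * σ ^ 2 * phiPol a s d ^ 2 := by
  have ha0 : 0 < a := by linarith
  have hβ : 2 / a < 1 := by rwa [div_lt_one ha0]
  have hβ' : 0 < 1 - 2 / a := by linarith
  obtain ⟨L, hL, htrunc⟩ := exists_truncation_level (τ ^ a) a (by positivity) ha
  obtain ⟨N, hN2, hNL⟩ := exists_block_number L
  obtain ⟨K, hK0, hK⟩ := exists_sum_rpow_le (β := 2 / a) (by positivity)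
  have hN0 : (2 : ℝ) ≤ N := by exact_mod_cast hN2
  set κ : ℝ := max 2 (2 * τ ^ a / (a - 2))
  have hκ2 : 2 ≤ κ := le_max_left _ _
  have hκ : 2 * τ ^ a / (a - 2) ≤ κ := le_max_right _ _
  have hκ0 : 0 < κ := by linarith
  refine ⟨9 * κ, 16 * (κ ^ 2 * K) + (2304 * N + 2592) * κ ^ 2 * (1 / (1 - 2 / a)), 1 / N,
    by positivity, by positivity, by positivity, one_div_le_one_div_of_le two_pos hN0, ?_⟩
  intro s d hs1 hs B hB V hV θhat hθhat P hP σ hσ θ hθ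
  have hPp := hP.1
  have hi := integrable_sq_of_integral_eq_one hP.2.2.1
  have h4s : 4 * s < ⌊1 / (N : ℝ) * d⌋₊ := by
    have : (4 * s : ℝ) < ⌊1 / (N : ℝ) * d⌋₊ := by linarith
    exact_mod_cast this
  obtain ⟨hblock, hdm, hmd⟩ := floor_inv_mul_bounds (N := N) (d := d) (by omega) (by omega)
  have hd0 : (0 : ℝ) < d := by exact_mod_cast (by omega : 0 < d)
  have hest : IsSlopeEstimator (fun j => 9 * κ * polWeights 1 a d j) V θhat := by
    have : (fun j => 9 * κ * polWeights 1 a d j) = polWeights (9 * κ) a d := by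
      funext j
      simp only [polWeights, one_mul]
    rwa [this]
  have hwd : polWeights 1 a d d = 1 := by
    rw [polWeights, div_self hd0.ne', Real.one_rpow, one_mul]
  have hmain := slope_risk_le_of_regular hi hP.2.2.1
    (v := fun i => ((i + 1 : ℕ) : ℝ) / d * (κ * polWeights 1 a d (i + 1)) ^ 2) hL
    (htrunc P hPp hi hP.2.2.1 (hasPowerTail_of_mem_polTailClass hτ hP)) (by omega) hNL hκ0
    zero_le_one (by positivity) hβ (polWeights_one_anti ha0 d) hwd
    (fun s j hj hjs _ => polWeights_regular d s j hj hjs)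
    (fun i => polTail_excess_le ha hτ hP hκ2 hκ (by omega) (by omega))
    (fun i => le_of_eq ?_) hs1 h4s hblock hdm hmd (sum_polTail_excess_le ha hK hs1) hB hV hest hθ hσ
  · rwa [mul_polWeights_one_sq] at hmain
  · push_cast
    field_simp

theorem mainTheorem1 :
    (∀ a τ : ℝ, 0 < a → 0 < τ →
      ∃ c C γ : ℝ, 0 < c ∧ 0 < C ∧ 0 < γ ∧ γ ≤ 1 / 2 ∧
        ∀ s d : ℕ, 1 ≤ s → (s : ℝ) < (⌊γ * (d : ℝ)⌋₊ : ℝ) / 4 →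
        ∀ B : Fin ⌊γ * (d : ℝ)⌋₊ → Finset (Fin d), IsBlockDivision B →
        ∀ V : EuclideanSpace ℝ (Fin d) → ℝ, IsMedianOfMeans B V →
        ∀ θhat : EuclideanSpace ℝ (Fin d) → EuclideanSpace ℝ (Fin d),
          IsSlopeEstimator (expWeights c a d) V θhat →
        ∀ P ∈ expTailClass a τ, ∀ σ : ℝ, 0 < σ →
        ∀ θ : EuclideanSpace ℝ (Fin d), sparsity θ ≤ s →
          Integrable (fun y => ‖θhat y - θ‖ ^ 2) (obsLaw θ P σ) ∧
          ∫ y, ‖θhat y - θ‖ ^ 2 ∂(obsLaw θ P σ) ≤ C * σ ^ 2 * phiExp a s d ^ 2) ∧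
    (∀ a τ : ℝ, 2 < a → 0 < τ →
      ∃ c C γ : ℝ, 0 < c ∧ 0 < C ∧ 0 < γ ∧ γ ≤ 1 / 2 ∧
        ∀ s d : ℕ, 1 ≤ s → (s : ℝ) < (⌊γ * (d : ℝ)⌋₊ : ℝ) / 4 →
        ∀ B : Fin ⌊γ * (d : ℝ)⌋₊ → Finset (Fin d), IsBlockDivision B →
        ∀ V : EuclideanSpace ℝ (Fin d) → ℝ, IsMedianOfMeans B V →
        ∀ θhat : EuclideanSpace ℝ (Fin d) → EuclideanSpace ℝ (Fin d),
          IsSlopeEstimator (polWeights c a d) V θhat →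
        ∀ P ∈ polTailClass a τ, ∀ σ : ℝ, 0 < σ →
        ∀ θ : EuclideanSpace ℝ (Fin d), sparsity θ ≤ s →
          Integrable (fun y => ‖θhat y - θ‖ ^ 2) (obsLaw θ P σ) ∧
          ∫ y, ‖θhat y - θ‖ ^ 2 ∂(obsLaw θ P σ) ≤ C * σ ^ 2 * phiPol a s d ^ 2) := by
  exact ⟨fun _ _ ha hτ => exists_risk_bound_expTailClass ha hτ,
    fun _ _ ha hτ => exists_risk_bound_polTailClass ha hτ⟩
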